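/- Let $\mu>0$, $\lambda\in\mathbb{R}$ with $2\mu+\lambda>0$, and $\gamma>1$. Consider the Cauchy problem for the one-dimensional full compressible Navier–Stokes system with zero heat conduction, $$\rho_t+(\rho u)_x=0,\qquad (\rho u)_t+(\rho u^2)_x+p_x=(2\mu+\lambda)u_{xx},\qquad (\rho e)_t+(\rho e u)_x+p\,u_x=(2\mu+\lambda)u_x^2,$$ for $x\in\mathbb{R}$, $0<t<T$, where $p=(\gamma-1)\rho e$, with initial data $(\rho,u,e)(x,0)=(\rho_0,u_0,e_0)(x)$, $x\in\mathbb{R}$. Let $\rho_0,u_0,e_0:\mathbb{R}\to\mathbb{R}$ be continuous, with $\operatorname{supp}\rho_0=[0,1]$ and $\rho_0>0$ on $(0,1)$, and with $e_0\ge 0$ on $(0,1)$ and $e_0\not\equiv0$ on $(0,1)$. Suppose that one of the following two conditions holds. (a) There are $\lambda_5>0$ and $0<\lambda_7<1$ such that $\rho_0,e_0$ are differentiable on $(0,\lambda_7)$ and $$\frac{(\rho_0)_x}{\rho_0}+\frac{(e_0)_x}{\rho_0}\ge\lambda_5\ \text{ on }(0,\lambda_7),\qquad u_0(\lambda_7)<0,\qquad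 u_0\le 0\ \text{ on }(0,\lambda_7).$$ (b) There are $\lambda_6>0$ and $0<\lambda_8<1$ such that $\rho_0,e_0$ are differentiable on $(\lambda_8,1)$ and $$\frac{(\rho_0)_x}{\rho_0}+\frac{(e_0)_x}{\rho_0}\le-\lambda_6\ \text{ on }(\lambda_8,1),\qquad u_0(\lambda_8)>0,\qquad u_0\ge 0\ \text{ on }(\lambda_8,1).$$ Then for every real $m>2$ and every $T>0$ the Cauchy problem has no solution $(\rho,u,e)$ with $\rho,u,e\in C^1([0,T];H^m(\mathbb{R}))$. Here $H^m(\mathbb{R})$ is the inhomogeneous $L^2$-based Sobolev space, functions in it are identified with their continuous representatives, and the equations are understood for every $t\in(0,T)$ and almost every $x\in\mathbb{R}$. -/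

import Mathlib

open MeasureTheory Set
open scoped SchwartzMap

namespace FullNS

/-- `f : ℝ → ℝ` is the continuous representative of an element of the Sobolev space `H^m(ℝ)`
(`m > 1/2`), and `g ∈ L²(ℝ)` is its Bessel potential `(1 + |ξ|²)^{m/2}(D) f`. Thus `f ∈ H^m(ℝ)` and
`‖f‖_{H^m} = ‖g‖_{L²}`. -/
def HasBesselLift (m : ℝ) (f : ℝ → ℝ) (g : Lp ℂ 2 (volume : Measure ℝ)) : Prop :=
  Continuous f ∧
    ∃ hf : MemLp (fun x : ℝ => (f x : ℂ)) 2 (volume : Measure ℝ),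
      TemperedDistribution.besselPotential ℝ ℂ m ((hf.toLp _ : Lp ℂ 2 (volume : Measure ℝ)) : 𝓢'(ℝ, ℂ))
        = (g : 𝓢'(ℝ, ℂ))

/-- `f ∈ C¹([0,T]; H^m(ℝ))`, where `f t` is the function of `x` at time `t`. As the Bessel potential
of order `m` is an isometry of `H^m(ℝ)` onto `L²(ℝ)`, this says that `t ↦ f t` is a `C¹` curve for
the norm of `H^m(ℝ)`. -/
def IsC1Sobolev (m T : ℝ) (f : ℝ → ℝ → ℝ) : Prop :=
  ∃ g : ℝ → Lp ℂ 2 (volume : Measure ℝ),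
    ContDiffOn ℝ 1 g (Icc 0 T) ∧ ∀ t ∈ Icc 0 T, HasBesselLift m (f t) (g t)

/-- The pressure of a polytropic gas, `p = (γ - 1) ρ e`. -/
def pressure (γ : ℝ) (ρ e : ℝ → ℝ → ℝ) (t x : ℝ) : ℝ := (γ - 1) * ρ t x * e t x

/-- `(ρ, u, e) ∈ C¹([0,T]; H^m(ℝ))` solves the Cauchy problem for the one-dimensional full
compressible Navier-Stokes system without heat conduction, with viscosity coefficients `μ`, `lam`,
adiabatic exponent `γ` and initial data `(ρ₀, u₀, e₀)`. The equations are required at every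
`t ∈ (0,T)` for almost every `x`. For `m > 2` every first derivative below is classical, while
`∂ₓ u` is locally absolutely continuous, so that `∂ₓ∂ₓ u` exists almost everywhere and is the weak
second derivative. -/
structure IsSolution (μ lam γ m T : ℝ) (ρ₀ u₀ e₀ : ℝ → ℝ) (ρ u e : ℝ → ℝ → ℝ) : Prop where
  regular_density : IsC1Sobolev m T ρ
  regular_velocity : IsC1Sobolev m T u
  regular_energy : IsC1Sobolev m T e
  mass : ∀ t ∈ Ioo 0 T, ∀ᵐ x : ℝ,
    deriv (fun s => ρ s x) t + deriv (fun y => ρ t y * u t y) x = 0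
  momentum : ∀ t ∈ Ioo 0 T, ∀ᵐ x : ℝ,
    deriv (fun s => ρ s x * u s x) t + deriv (fun y => ρ t y * u t y * u t y) x
        + deriv (fun y => pressure γ ρ e t y) x
      = μ * deriv (deriv (u t)) x + (μ + lam) * deriv (deriv (u t)) x
  energy : ∀ t ∈ Ioo 0 T, ∀ᵐ x : ℝ,
    deriv (fun s => ρ s x * e s x) t + deriv (fun y => ρ t y * e t y * u t y) x
        + pressure γ ρ e t x * deriv (u t) x
      = μ / 2 * (deriv (u t) x + deriv (u t) x) ^ 2 + lam * (deriv (u t) x) ^ 2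
  initial_density : ∀ x, ρ 0 x = ρ₀ x
  initial_velocity : ∀ x, u 0 x = u₀ x
  initial_energy : ∀ x, e 0 x = e₀ x

/-- The condition on the initial data near the left end point of `(0,1)`. -/
def LeftCondition (ρ₀ u₀ e₀ : ℝ → ℝ) : Prop :=
  ∃ l₅ l₇ : ℝ, 0 < l₅ ∧ 0 < l₇ ∧ l₇ < 1 ∧
    (∀ x ∈ Ioo 0 l₇, DifferentiableAt ℝ ρ₀ x ∧ DifferentiableAt ℝ e₀ x ∧
      l₅ ≤ deriv ρ₀ x / ρ₀ x + deriv e₀ x / ρ₀ x) ∧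
    u₀ l₇ < 0 ∧ ∀ x ∈ Ioo 0 l₇, u₀ x ≤ 0

/-- The condition on the initial data near the right end point of `(0,1)`. -/
def RightCondition (ρ₀ u₀ e₀ : ℝ → ℝ) : Prop :=
  ∃ l₆ l₈ : ℝ, 0 < l₆ ∧ 0 < l₈ ∧ l₈ < 1 ∧
    (∀ x ∈ Ioo l₈ 1, DifferentiableAt ℝ ρ₀ x ∧ DifferentiableAt ℝ e₀ x ∧
      deriv ρ₀ x / ρ₀ x + deriv e₀ x / ρ₀ x ≤ -l₆) ∧
    0 < u₀ l₈ ∧ ∀ x ∈ Ioo l₈ 1, 0 ≤ u₀ x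

end FullNS

/-!
Write `q = ρ e` and `ν = 2μ + λ`. A solution of class `C¹([0,T]; H^m)` is a pointwise solution with
continuous first derivatives. In the vacuum the energy equation forces `∂ₓ u = 0`, hence `u = 0`, so
the vacuum boundary does not move and `u = ∂ₓ u = 0` there. The momentum of `[0,x]` relative to an
exponential barrier obeys a maximum principle, which forces a nonzero velocity at the boundary if
the initial velocity points outwards; the pressure only enters through its sign.
-/

namespace FullNS

open Filter Topology

/-! The vacuum boundary is rigid. In an open vacuum region `q = ρ e` vanishes identically, so the
energy balance reduces to `ν uₓ² = 0`. On the half-line to the left of the gas `u` is then constant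
in space, and a constant in `L²` of a half-line is zero. Hence the characteristic issuing from the
origin never leaves it, and `u` and `uₓ` vanish there (`vacuum_left`, `gradient_zero_left`).

Outward motion inside the gas contradicts this. For a reference velocity `b` put `D(t,x) = ∫₀ˣ ρ (u
- b)`. The flux at `x = 0` vanishes, so `Dₓ = ρ (u - b)` and `D_t = ν uₓ - (γ - 1) q + ρ u (b - u) -
∫₀ˣ ρ (u bₓ + b_t)`. At an interior spatial maximum `u = b` and `uₓ ≤ bₓ`; since `q ≥ 0`, `D_t ≤ 0`
follows from `ν bₓ ≤ ∫₀ˣ ρ (u bₓ + b_t)`. This gives a maximum principle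
(`relative_momentum_nonpos`) that never divides by the degenerate density and needs no second
derivative of `u`.

The barrier `b = ε (1 - exp (K (x - a + L t)))` lies above `u` initially and at a point `l` inside
the gas. Its zero moves left with speed `L` and passes the origin, after which `b < 0 = u` there.
Then `D > 0` just to the right of the origin, a contradiction (`false_of_left`). The right boundary
follows by reflection (`false_of_right`).

The remaining work is regularity (`exists_field`, `exists_pointwise`). A function in `H^m` is the
inverse Fourier transform of the Bessel symbol times an `L²` function. For `m > 2` the symbols of
`f` and `fₓ` are in `L²` and that of `fₓₓ` is bounded. So `f` is `C¹` with `fₓ` locally absolutely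
continuous, which suffices for pointwise mass and energy balances and a momentum balance integrated
once in space. -/

/-- A function of time and space, continuous together with its first partial derivatives. The time
derivative is only required on `(0,T)`. -/
structure IsC1Field (T : ℝ) (f fx ft : ℝ → ℝ → ℝ) : Prop where
  cont : Continuous (Function.uncurry f)
  cont_x : Continuous (Function.uncurry fx)
  cont_t : Continuous (Function.uncurry ft)
  deriv_x : ∀ t x, HasDerivAt (f t) (fx t x) x
  deriv_t : ∀ t ∈ Ioo 0 T, ∀ x, HasDerivAt (fun s => f s x) (ft t x) t

/-- A solution of the equations in which the velocity gradient is continuous: mass and energy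
balance hold pointwise and the momentum balance holds on every interval. Here `q = ρ e`. -/
structure IsPointwiseSolution (ν γ T : ℝ) (ρ ρx ρt u ux ut q qx qt : ℝ → ℝ → ℝ) : Prop where
  density : IsC1Field T ρ ρx ρt
  velocity : IsC1Field T u ux ut
  internal : IsC1Field T q qx qt
  bound : ∃ C : ℝ, ∀ t x, |ρ t x| ≤ C ∧ |u t x| ≤ C ∧ |ux t x| ≤ C
  memLp : ∀ t, MemLp (u t) 2 volume
  vacuum : ∀ t x, ρ t x = 0 → q t x = 0
  mass : ∀ t ∈ Ioo 0 T, ∀ x, ρt t x + ρx t x * u t x + ρ t x * ux t x = 0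
  energy : ∀ t ∈ Ioo 0 T, ∀ x,
    qt t x + qx t x * u t x + γ * (q t x * ux t x) = ν * ux t x ^ 2
  momentum : ∀ t ∈ Ioo 0 T, ∀ a b,
    ∫ x in a..b, (ρt t x * u t x + ρ t x * ut t x) =
      (ν * ux t b - ρ t b * u t b ^ 2 - (γ - 1) * q t b) -
        (ν * ux t a - ρ t a * u t a ^ 2 - (γ - 1) * q t a)

/-! ### Characteristics of the velocity and transport along them. -/

section Characteristics

variable {T : ℝ} {f fx ft : ℝ → ℝ → ℝ}

lemma IsC1Field.mul {g gx gt : ℝ → ℝ → ℝ} (hf : IsC1Field T f fx ft) (hg : IsC1Field T g gx gt) :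
    IsC1Field T (fun t x => f t x * g t x) (fun t x => fx t x * g t x + f t x * gx t x)
      (fun t x => ft t x * g t x + f t x * gt t x) where
  cont := hf.cont.mul hg.cont
  cont_x := (hf.cont_x.mul hg.cont).add (hf.cont.mul hg.cont_x)
  cont_t := (hf.cont_t.mul hg.cont).add (hf.cont.mul hg.cont_t)
  deriv_x t x := (hf.deriv_x t x).mul (hg.deriv_x t x)
  deriv_t t ht x := (hf.deriv_t t ht x).mul (hg.deriv_t t ht x)

/-- The chain rule along a curve. -/
lemma IsC1Field.hasDerivAt_along (hf : IsC1Field T f fx ft) {X : ℝ → ℝ} {s v : ℝ}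
    (hs : s ∈ Ioo 0 T) (hX : HasDerivAt X v s) :
    HasDerivAt (fun r => f r (X r)) (ft s (X s) + fx s (X s) * v) s := by
  have key : HasStrictFDerivAt (Function.uncurry f)
      ((ContinuousLinearMap.toSpanSingleton ℝ (ft s (X s))).coprod
        (ContinuousLinearMap.toSpanSingleton ℝ (fx s (X s)))) (s, X s) := by
    refine hasStrictFDerivAt_uncurry_coprod (u := (s, X s)) (f := f)
      (f₁ := fun t x => ContinuousLinearMap.toSpanSingleton ℝ (ft t x))
      (f₂ := fun t x => ContinuousLinearMap.toSpanSingleton ℝ (fx t x)) ?_ ?_ ?_ ?_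
    · have : ∀ᶠ v in 𝓝 (s, X s), v.1 ∈ Ioo 0 T :=
        continuousAt_fst.eventually (Ioo_mem_nhds hs.1 hs.2)
      filter_upwards [this] with v hv
      exact (hf.deriv_t v.1 hv v.2).hasFDerivAt
    · filter_upwards with v
      exact (hf.deriv_x v.1 v.2).hasFDerivAt
    · exact ((ContinuousLinearMap.toSpanSingletonCLE (𝕜 := ℝ) (E := ℝ)).continuous.comp
        hf.cont_t).continuousAt
    · exact ((ContinuousLinearMap.toSpanSingletonCLE (𝕜 := ℝ) (E := ℝ)).continuous.comp
        hf.cont_x).continuousAt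
  have h2 : HasDerivAt (fun r => (r, X r)) (1, v) s := (hasDerivAt_id s).prodMk hX
  have := key.hasFDerivAt.comp_hasDerivAt s h2
  simpa [Function.comp_def, Function.uncurry, mul_comm] using this

/-- `X` is a characteristic of the velocity `u` on `[0,T]`. -/
def IsCharacteristic (T : ℝ) (u : ℝ → ℝ → ℝ) (X : ℝ → ℝ) : Prop :=
  ∀ s ∈ Icc 0 T, HasDerivAt X (u s (X s)) s

lemma lipschitzWith_of_field {u ux : ℝ → ℝ → ℝ} {C : ℝ} (h : ∀ t x, HasDerivAt (u t) (ux t x) x)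
    (hC : ∀ t x, |ux t x| ≤ C) (t : ℝ) : LipschitzWith C.toNNReal (u t) := by
  refine lipschitzWith_of_nnnorm_deriv_le (fun x => (h t x).differentiableAt) fun x => ?_
  rw [(h t x).deriv, ← NNReal.coe_le_coe, coe_nnnorm, Real.norm_eq_abs]
  exact (hC t x).trans (Real.le_coe_toNNReal C)

/-- The velocity is bounded and Lipschitz in space uniformly in time, so one application of
Picard–Lindelöf covers the whole time interval and no continuation argument is needed. -/
lemma exists_isCharacteristic {u : ℝ → ℝ → ℝ} {C : ℝ} {K : NNReal}
    (hu : Continuous (Function.uncurry u)) (hlip : ∀ t, LipschitzWith K (u t))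
    (hC : ∀ t x, |u t x| ≤ C) {t₁ : ℝ} (ht₁ : t₁ ∈ Icc 0 T) (x₁ : ℝ) :
    ∃ X, X t₁ = x₁ ∧ IsCharacteristic T u X := by
  have hC0 : 0 ≤ C := (abs_nonneg _).trans (hC 0 0)
  have hT : 0 ≤ T := ht₁.1.trans ht₁.2
  -- Solving on a larger interval makes the derivatives at `0` and `T` two-sided.
  let t₀ : Icc (-1) (T + 1) := ⟨t₁, by constructor <;> linarith [ht₁.1, ht₁.2]⟩
  have hPL : IsPicardLindelof u t₀ x₁ (C * (T + 1)).toNNReal 0 C.toNNReal K := by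
    refine ⟨fun t _ => (hlip t).lipschitzOnWith, fun x _ => ?_, fun t _ x _ => ?_, ?_⟩
    · exact (hu.comp (continuous_id.prodMk continuous_const)).continuousOn
    · rw [Real.norm_eq_abs]
      exact (hC t x).trans (Real.le_coe_toNNReal C)
    · rw [Real.coe_toNNReal _ hC0, Real.coe_toNNReal _ (by positivity)]
      simp only [NNReal.coe_zero, sub_zero, t₀]
      gcongr
      exact max_le (by linarith [ht₁.1]) (by linarith [ht₁.2])
  obtain ⟨X, hX1, hX2⟩ := hPL.exists_eq_forall_mem_Icc_hasDerivWithinAt₀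
  refine ⟨X, hX1, fun s hs => ?_⟩
  exact (hX2 s ⟨by linarith [hs.1], by linarith [hs.2]⟩).hasDerivAt
    (Icc_mem_nhds (by linarith [hs.1]) (by linarith [hs.2]))

lemma IsCharacteristic.continuousOn {u : ℝ → ℝ → ℝ} {X : ℝ → ℝ} (hX : IsCharacteristic T u X) :
    ContinuousOn X (Icc 0 T) :=
  fun s hs => (hX s hs).continuousAt.continuousWithinAt

/-- Characteristics do not cross. -/
lemma IsCharacteristic.le_of_le {u : ℝ → ℝ → ℝ} {K : NNReal} (hlip : ∀ t, LipschitzWith K (u t))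
    {X Y : ℝ → ℝ} (hX : IsCharacteristic T u X) (hY : IsCharacteristic T u Y) {s t : ℝ}
    (hs : s ∈ Icc 0 T) (ht : t ∈ Icc 0 T) (h : X s ≤ Y s) : X t ≤ Y t := by
  by_contra! hlt
  have hsub : uIcc s t ⊆ Icc 0 T := fun r hr =>
    ⟨(le_min hs.1 ht.1).trans hr.1, hr.2.trans (max_le hs.2 ht.2)⟩
  have hc : ContinuousOn (fun r => X r - Y r) (uIcc s t) :=
    (hX.continuousOn.sub hY.continuousOn).mono hsub
  -- If the order were reversed, the curves would meet at some time `r` between `s` and `t`;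
  -- uniqueness from `r`, forwards or backwards, then makes them agree at `t`.
  obtain ⟨r, hr, hr0⟩ : (0 : ℝ) ∈ (fun r => X r - Y r) '' uIcc s t :=
    intermediate_value_uIcc hc (by
      rw [uIcc_of_le (by linarith)]; constructor <;> linarith)
  have hr' := hsub hr
  have heq : X r = Y r := by simpa [sub_eq_zero] using hr0
  rcases le_total r t with hrt | hrt
  · have := ODE_solution_unique (v := u) (a := r) (b := t) hlip
      (hX.continuousOn.mono (Icc_subset_Icc hr'.1 ht.2))
      (fun z hz => (hX z ⟨hr'.1.trans hz.1, hz.2.le.trans ht.2⟩).hasDerivWithinAt)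
      (hY.continuousOn.mono (Icc_subset_Icc hr'.1 ht.2))
      (fun z hz => (hY z ⟨hr'.1.trans hz.1, hz.2.le.trans ht.2⟩).hasDerivWithinAt) heq
      ⟨hrt, le_rfl⟩
    linarith
  · have := ODE_solution_unique_of_mem_Icc_left (v := u) (a := t) (b := r) (s := fun _ => univ)
      (fun z _ => (hlip z).lipschitzOnWith)
      (hX.continuousOn.mono (Icc_subset_Icc ht.1 hr'.2))
      (fun z hz => (hX z ⟨ht.1.trans hz.1.le, hz.2.trans hr'.2⟩).hasDerivWithinAt)
      (fun _ _ => trivial)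
      (hY.continuousOn.mono (Icc_subset_Icc ht.1 hr'.2))
      (fun z hz => (hY z ⟨ht.1.trans hz.1.le, hz.2.trans hr'.2⟩).hasDerivWithinAt)
      (fun _ _ => trivial) heq ⟨le_rfl, hrt⟩
    linarith

lemma IsCharacteristic.abs_sub_le {u : ℝ → ℝ → ℝ} {C : ℝ} (hC : ∀ t x, |u t x| ≤ C)
    {X : ℝ → ℝ} (hX : IsCharacteristic T u X) {t : ℝ} (ht : t ∈ Icc 0 T) :
    |X t - X 0| ≤ C * t := by
  have := (convex_Icc 0 t).norm_image_sub_le_of_norm_hasDerivWithin_le (f := X)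
    (f' := fun s => u s (X s)) (C := C) (x := 0) (y := t)
    (fun s hs => (hX s ⟨hs.1, hs.2.trans ht.2⟩).hasDerivWithinAt)
    (fun s _ => hC _ _) ⟨le_rfl, ht.1⟩ ⟨ht.1, le_rfl⟩
  simpa [Real.norm_eq_abs, abs_of_nonneg ht.1] using this

/-- An integrating factor turns `r' + c r ≥ 0` into a lower bound. -/
lemma le_mul_exp_of_deriv_add_nonneg {r r' c : ℝ → ℝ} {t : ℝ} (ht : 0 ≤ t)
    (hrc : ContinuousOn r (Icc 0 t)) (hr : ∀ s ∈ Ioo 0 t, HasDerivAt r (r' s) s)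
    (hc : ContinuousOn c (Icc 0 t)) (h : ∀ s ∈ Ioo 0 t, 0 ≤ r' s + c s * r s) :
    r 0 ≤ r t * Real.exp (∫ s in (0 : ℝ)..t, c s) := by
  have hci : IntegrableOn c (Icc 0 t) := hc.integrableOn_Icc
  have hI : ∀ s ∈ Ioo 0 t, HasDerivAt (fun z => ∫ y in (0 : ℝ)..z, c y) (c s) s := fun s hs => by
    refine intervalIntegral.integral_hasDerivAt_right
      ((hc.mono (Icc_subset_Icc le_rfl hs.2.le)).intervalIntegrable_of_Icc hs.1.le) ?_
      (hc.continuousAt (Icc_mem_nhds hs.1 hs.2))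
    exact hc.stronglyMeasurableAtFilter_nhdsWithin measurableSet_Icc s |>.filter_mono
      (by rw [nhdsWithin_eq_nhds.2 (Icc_mem_nhds hs.1 hs.2)])
  have hmono : MonotoneOn (fun z => r z * Real.exp (∫ y in (0 : ℝ)..z, c y)) (Icc 0 t) := by
    refine monotoneOn_of_deriv_nonneg (convex_Icc 0 t) ?_ ?_ ?_
    · refine hrc.mul (Real.continuous_exp.comp_continuousOn ?_)
      have := intervalIntegral.continuousOn_primitive_interval (μ := volume) (a := 0) (b := t)
        (f := c) (by rwa [uIcc_of_le ht])
      rwa [uIcc_of_le ht] at this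
    · rw [interior_Icc]
      exact fun s hs => ((hr s hs).mul (hI s hs).exp).differentiableAt.differentiableWithinAt
    · rw [interior_Icc]
      intro s hs
      rw [((hr s hs).fun_mul (hI s hs).exp).deriv]
      have := mul_nonneg (h s hs) (Real.exp_pos (∫ y in (0 : ℝ)..s, c y)).le
      linarith
  simpa using hmono ⟨le_rfl, ht⟩ ⟨ht, le_rfl⟩ ht

end Characteristics

/-! ### Rigidity of the vacuum and of its boundary. -/

section Vacuum

/-- A half-line has infinite measure. This is where decay at infinity fixes the constant velocity of
the vacuum. -/
lemma eq_zero_of_memLp_of_eqOn_Iio {f : ℝ → ℝ} (hf : MemLp f 2 volume) {a c : ℝ}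
    (h : ∀ x < a, f x = c) : c = 0 := by
  have h1 : MemLp (fun _ : ℝ => c) 2 (volume.restrict (Iio a)) :=
    (hf.restrict (Iio a)).ae_eq ((ae_restrict_mem measurableSet_Iio).mono fun x hx => h x hx)
  rcases (memLp_const_iff (by norm_num) (by norm_num)).1 h1 with h2 | h2
  · exact h2
  · simp at h2

variable {ν γ T : ℝ} {ρ ρx ρt u ux ut q qx qt : ℝ → ℝ → ℝ}

lemma IsC1Field.continuousOn_along {f fx ft : ℝ → ℝ → ℝ} (hf : IsC1Field T f fx ft) {X : ℝ → ℝ}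
    (hX : IsCharacteristic T u X) : ContinuousOn (fun s => f s (X s)) (Icc 0 T) :=
  hf.cont.comp_continuousOn (continuousOn_id.prodMk hX.continuousOn)

lemma IsPointwiseSolution.continuousOn_gradient_along
    (h : IsPointwiseSolution ν γ T ρ ρx ρt u ux ut q qx qt) {X : ℝ → ℝ}
    (hX : IsCharacteristic T u X) : ContinuousOn (fun s => ux s (X s)) (Icc 0 T) :=
  h.velocity.cont_x.comp_continuousOn (continuousOn_id.prodMk hX.continuousOn)

/-- The density is transported along characteristics. -/
lemma IsPointwiseSolution.density_along
    (h : IsPointwiseSolution ν γ T ρ ρx ρt u ux ut q qx qt) {X : ℝ → ℝ}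
    (hX : IsCharacteristic T u X) {t : ℝ} (ht : t ∈ Icc 0 T) :
    ρ 0 (X 0) = ρ t (X t) * Real.exp (∫ s in (0 : ℝ)..t, ux s (X s)) := by
  have hsub : Icc 0 t ⊆ Icc 0 T := Icc_subset_Icc le_rfl ht.2
  have hc := (h.density.continuousOn_along hX).mono hsub
  have hd : ∀ s ∈ Ioo 0 t, HasDerivAt (fun r => ρ r (X r))
      (-(ux s (X s) * ρ s (X s))) s := fun s hs => by
    have hs' : s ∈ Ioo 0 T := ⟨hs.1, hs.2.trans_le ht.2⟩
    convert h.density.hasDerivAt_along hs' (hX s (Ioo_subset_Icc_self hs')) using 1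
    linarith [h.mass s hs' (X s)]
  -- The mass balance is an equality, so the integrating factor bound applies to both `ρ` and `-ρ`.
  refine le_antisymm ?_ ?_
  · exact le_mul_exp_of_deriv_add_nonneg ht.1 hc hd
      ((h.continuousOn_gradient_along hX).mono hsub) fun s _ => by simp
  · have := le_mul_exp_of_deriv_add_nonneg ht.1 hc.neg (fun s hs => (hd s hs).neg)
      ((h.continuousOn_gradient_along hX).mono hsub) fun s _ => by simp
    simp only [Pi.neg_apply] at this
    linarith

/-- The internal energy per volume does not lose its sign along characteristics. -/
lemma IsPointwiseSolution.internal_along (hν : 0 ≤ ν)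
    (h : IsPointwiseSolution ν γ T ρ ρx ρt u ux ut q qx qt) {X : ℝ → ℝ}
    (hX : IsCharacteristic T u X) {t : ℝ} (ht : t ∈ Icc 0 T) :
    q 0 (X 0) ≤ q t (X t) * Real.exp (∫ s in (0 : ℝ)..t, γ * ux s (X s)) := by
  have hsub : Icc 0 t ⊆ Icc 0 T := Icc_subset_Icc le_rfl ht.2
  refine le_mul_exp_of_deriv_add_nonneg (r' := fun s => qt s (X s) + qx s (X s) * u s (X s)) ht.1
    ((h.internal.continuousOn_along hX).mono hsub) (fun s hs => ?_)
    (continuousOn_const.mul ((h.continuousOn_gradient_along hX).mono hsub)) fun s hs => ?_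
  · have hs' : s ∈ Ioo 0 T := ⟨hs.1, hs.2.trans_le ht.2⟩
    exact h.internal.hasDerivAt_along hs' (hX s (Ioo_subset_Icc_self hs'))
  · have hs' : s ∈ Ioo 0 T := ⟨hs.1, hs.2.trans_le ht.2⟩
    have := h.energy s hs' (X s)
    -- Viscous heating is a source with a sign.
    have h2 : 0 ≤ ν * ux s (X s) ^ 2 := by positivity
    linarith

lemma IsPointwiseSolution.exists_lipschitz
    (h : IsPointwiseSolution ν γ T ρ ρx ρt u ux ut q qx qt) :
    ∃ K : NNReal, ∀ t, LipschitzWith K (u t) := by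
  obtain ⟨C, hC⟩ := h.bound
  exact ⟨_, lipschitzWith_of_field h.velocity.deriv_x fun t x => (hC t x).2.2⟩

lemma IsPointwiseSolution.exists_characteristic
    (h : IsPointwiseSolution ν γ T ρ ρx ρt u ux ut q qx qt) {t₁ : ℝ} (ht₁ : t₁ ∈ Icc 0 T)
    (x₁ : ℝ) : ∃ X, X t₁ = x₁ ∧ IsCharacteristic T u X := by
  obtain ⟨C, hC⟩ := h.bound
  obtain ⟨K, hK⟩ := h.exists_lipschitz
  exact exists_isCharacteristic h.velocity.cont hK (fun t x => (hC t x).2.1) ht₁ x₁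

lemma IsPointwiseSolution.density_nonneg
    (h : IsPointwiseSolution ν γ T ρ ρx ρt u ux ut q qx qt) (h0 : ∀ x, 0 ≤ ρ 0 x) {t : ℝ}
    (ht : t ∈ Icc 0 T) (x : ℝ) : 0 ≤ ρ t x := by
  obtain ⟨X, rfl, hX⟩ := h.exists_characteristic ht x
  have := h.density_along hX ht
  exact nonneg_of_mul_nonneg_left (this ▸ h0 (X 0)) (Real.exp_pos _)

lemma IsPointwiseSolution.internal_nonneg (hν : 0 ≤ ν)
    (h : IsPointwiseSolution ν γ T ρ ρx ρt u ux ut q qx qt) (h0 : ∀ x, 0 ≤ q 0 x) {t : ℝ}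
    (ht : t ∈ Icc 0 T) (x : ℝ) : 0 ≤ q t x := by
  obtain ⟨X, rfl, hX⟩ := h.exists_characteristic ht x
  exact nonneg_of_mul_nonneg_left ((h0 (X 0)).trans (h.internal_along hν hX ht)) (Real.exp_pos _)

/-- In an open vacuum region the velocity is locally constant in space. -/
lemma IsPointwiseSolution.gradient_eq_zero (hν : 0 < ν)
    (h : IsPointwiseSolution ν γ T ρ ρx ρt u ux ut q qx qt) {t x : ℝ} (ht : t ∈ Ioo 0 T)
    (hvac : ∀ᶠ p in 𝓝 (t, x), ρ p.1 p.2 = 0) : ux t x = 0 := by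
  have hq : ∀ᶠ p in 𝓝 (t, x), q p.1 p.2 = 0 := hvac.mono fun p hp => h.vacuum _ _ hp
  have hqt : qt t x = 0 := by
    have h1 : (fun s => q s x) =ᶠ[𝓝 t] fun _ => 0 :=
      (continuous_id.prodMk continuous_const : Continuous fun s : ℝ => (s, x)).continuousAt.eventually
        hq
    exact (h.internal.deriv_t t ht x).unique ((hasDerivAt_const t 0).congr_of_eventuallyEq h1)
  have hqx : qx t x = 0 := by
    have h1 : q t =ᶠ[𝓝 x] fun _ => 0 :=
      (continuous_const.prodMk continuous_id : Continuous fun y : ℝ => (t, y)).continuousAt.eventually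
        hq
    exact (h.internal.deriv_x t x).unique ((hasDerivAt_const x 0).congr_of_eventuallyEq h1)
  have := h.energy t ht x
  rw [hqt, hqx, hq.self_of_nhds] at this
  have h2 : ν * ux t x ^ 2 = 0 := by linarith
  simpa [hν.ne'] using h2

/-- The vacuum to the left of the origin does not move, and the velocity vanishes there. -/
lemma IsPointwiseSolution.vacuum_left (hν : 0 < ν)
    (h : IsPointwiseSolution ν γ T ρ ρx ρt u ux ut q qx qt) (hT : 0 < T)
    (h0 : ∀ x ≤ 0, ρ 0 x = 0) :
    (∀ t ∈ Icc 0 T, ∀ x ≤ 0, ρ t x = 0) ∧ (∀ t ∈ Ioo 0 T, ∀ x ≤ 0, u t x = 0) ∧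
      IsCharacteristic T u (fun _ => 0) := by
  obtain ⟨K, hK⟩ := h.exists_lipschitz
  obtain ⟨Z, hZ0, hZ⟩ := h.exists_characteristic ⟨le_rfl, hT.le⟩ 0
  have hvac : ∀ t ∈ Icc 0 T, ∀ x ≤ Z t, ρ t x = 0 := by
    intro t ht x hx
    obtain ⟨X, rfl, hX⟩ := h.exists_characteristic ht x
    have h1 : X 0 ≤ 0 := (hX.le_of_le hK hZ ht ⟨le_rfl, hT.le⟩ hx).trans_eq hZ0
    have h2 := h.density_along hX ht
    rw [h0 _ h1] at h2
    simpa [(Real.exp_pos _).ne'] using h2.symm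
  have hux : ∀ t ∈ Ioo 0 T, ∀ x < Z t, ux t x = 0 := by
    intro t ht x hx
    refine h.gradient_eq_zero hν ht ?_
    have hc : ContinuousAt (fun p : ℝ × ℝ => Z p.1 - p.2) (t, x) :=
      (ContinuousAt.comp (f := Prod.fst) (g := Z) (x := ((t, x) : ℝ × ℝ))
        (hZ t (Ioo_subset_Icc_self ht)).continuousAt continuousAt_fst).sub continuousAt_snd
    filter_upwards [hc.eventually (lt_mem_nhds (show (0 : ℝ) < Z t - x by linarith)),
      continuousAt_fst.eventually (Ioo_mem_nhds ht.1 ht.2)] with p hp1 hp2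
    exact hvac p.1 (Ioo_subset_Icc_self hp2) p.2 (by linarith)
  have hu : ∀ t ∈ Ioo 0 T, ∀ x ≤ Z t, u t x = 0 := by
    intro t ht
    have hcu : Continuous (u t) := h.velocity.cont.comp (continuous_const.prodMk continuous_id)
    -- The point `Z t - 1` is an arbitrary base point in the vacuum.
    have hconst : ∀ x < Z t, u t x = u t (Z t - 1) := fun x hx =>
      (convex_Iio (Z t)).is_const_of_fderivWithin_eq_zero (𝕜 := ℝ) (f := u t)
        (fun y _ => (h.velocity.deriv_x t y).differentiableAt.differentiableWithinAt)
        (fun y hy => by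
          have := (h.velocity.deriv_x t y).hasFDerivAt.hasFDerivWithinAt (s := Iio (Z t))
          rw [this.fderivWithin (isOpen_Iio.uniqueDiffWithinAt hy), hux t ht y hy]
          simp) hx (by simp)
    have hz := eq_zero_of_memLp_of_eqOn_Iio (h.memLp t) hconst
    have hcl : ∀ x ∈ closure (Iio (Z t)), u t x = 0 := fun x hx =>
      closure_minimal (t := {x | u t x = 0}) (fun y hy => (hconst y hy).trans hz)
        (isClosed_eq hcu continuous_const) hx
    intro x hx
    exact hcl x (by rwa [closure_Iio])
  have hZ00 : ∀ t ∈ Icc 0 T, Z t = 0 := by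
    intro t ht
    refine (constant_of_has_deriv_right_zero hZ.continuousOn (fun s hs => ?_) t ht).trans hZ0
    -- The equations are not available at time `0`, so the boundary velocity there is obtained as a
    -- limit from positive times.
    rcases eq_or_lt_of_le hs.1 with rfl | hs0
    · have hcont : ContinuousWithinAt (fun s => u s (Z s)) (Ici 0) 0 :=
        (h.velocity.cont.continuousAt.comp (x := 0)
          (continuousAt_id.prodMk (hZ 0 ⟨le_rfl, hT.le⟩).continuousAt)).continuousWithinAt
      have h1 : u 0 (Z 0) = 0 := by
        refine tendsto_nhds_unique (l := 𝓝[>] (0 : ℝ)) (f := fun s => u s (Z s))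
          (hcont.mono Ioi_subset_Ici_self) ?_
        refine tendsto_const_nhds.congr' ?_
        filter_upwards [Ioo_mem_nhdsGT hT] with s hs
        exact (hu s hs _ le_rfl).symm
      simpa [h1] using (hZ 0 ⟨le_rfl, hT.le⟩).hasDerivWithinAt (s := Ici 0)
    · have h1 := hZ s ⟨hs0.le, hs.2.le⟩
      rw [hu s ⟨hs0, hs.2⟩ _ le_rfl] at h1
      exact h1.hasDerivWithinAt
  refine ⟨fun t ht x hx => hvac t ht x (by rwa [hZ00 t ht]),
    fun t ht x hx => hu t ht x (by rwa [hZ00 t (Ioo_subset_Icc_self ht)]), fun s hs => ?_⟩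
  have hclosed : ∀ t ∈ Icc 0 T, u t 0 = 0 := by
    intro t ht
    have hc : Continuous fun t => u t 0 :=
      h.velocity.cont.comp (continuous_id.prodMk continuous_const)
    have : Icc 0 T ⊆ {t | u t 0 = 0} := by
      rw [← closure_Ioo hT.ne]
      refine closure_minimal (fun t ht => ?_) (isClosed_eq hc continuous_const)
      exact hu t ht 0 (hZ00 t (Ioo_subset_Icc_self ht)).ge
    exact this ht
  simpa [hclosed s hs] using hasDerivAt_const s (0 : ℝ)

/-- For short times the density stays positive on `(0,l]`. -/
lemma IsPointwiseSolution.density_pos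
    (h : IsPointwiseSolution ν γ T ρ ρx ρt u ux ut q qx qt)
    (h0 : IsCharacteristic T u (fun _ => 0)) (hpos : ∀ x ∈ Ioo 0 1, 0 < ρ 0 x) {C l : ℝ}
    (hC : ∀ t x, |u t x| ≤ C) {t x : ℝ} (ht : t ∈ Icc 0 T) (hl : l + C * t < 1) (hx : 0 < x)
    (hxl : x ≤ l) : 0 < ρ t x := by
  obtain ⟨K, hK⟩ := h.exists_lipschitz
  obtain ⟨X, rfl, hX⟩ := h.exists_characteristic ht x
  have hT : (0 : ℝ) ∈ Icc 0 T := ⟨le_rfl, ht.1.trans ht.2⟩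
  have h1 : 0 < X 0 := by
    by_contra! hle
    exact absurd (hX.le_of_le hK h0 hT ht hle) (not_le.2 hx)
  -- The right boundary is not controlled here; finite speed of propagation keeps the foot of the
  -- characteristic inside the gas for short times.
  have h2 : X 0 < 1 := by
    have := abs_le.1 (hX.abs_sub_le hC ht)
    linarith [this.1]
  have := h.density_along hX ht
  exact pos_of_mul_pos_left (this ▸ hpos _ ⟨h1, h2⟩) (Real.exp_pos _).le

/-- The two-sided derivative at the boundary is determined by its vacuum side. -/
lemma IsPointwiseSolution.gradient_zero_left
    (h : IsPointwiseSolution ν γ T ρ ρx ρt u ux ut q qx qt) {t : ℝ}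
    (hu : ∀ x ≤ 0, u t x = 0) : ux t 0 = 0 := by
  have h1 := (h.velocity.deriv_x t 0).hasDerivWithinAt (s := Iic 0)
  have h2 : HasDerivWithinAt (u t) 0 (Iic 0) 0 :=
    (hasDerivWithinAt_const 0 (Iic 0) (0 : ℝ)).congr (fun x hx => hu x hx) (hu 0 le_rfl)
  exact (uniqueDiffWithinAt_Iic 0).eq_deriv _ h1 h2

end Vacuum

/-! ### Maximum principle for the relative momentum, and the barrier. -/

section Comparison

/-- Looking only to the left, this also excludes maxima at the right end of an interval, in space or
in time. -/
lemma exists_lt_left_of_hasDerivAt_neg {f : ℝ → ℝ} {f' a c : ℝ} (hf : HasDerivAt f f' a)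
    (hf' : f' < 0) (hc : c < a) : ∃ y ∈ Ioo c a, f a < f y := by
  have h1 := (hasDerivAt_iff_tendsto_slope.1 hf).eventually (gt_mem_nhds hf')
  have h2 : ∀ᶠ y in 𝓝[<] a, slope f a y < 0 :=
    h1.filter_mono (nhdsWithin_mono a fun y hy => ne_of_lt hy)
  obtain ⟨y, hy1, hy2⟩ := (h2.and (Ioo_mem_nhdsLT hc)).exists
  refine ⟨y, hy2, ?_⟩
  rw [slope_def_field, div_neg_iff] at hy1
  rcases hy1 with hy1 | hy1 <;> linarith [hy1.1, hy1.2, hy2.2]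

lemma eventually_pos_right_of_hasDerivAt_pos {f : ℝ → ℝ} {f' a : ℝ} (hf : HasDerivAt f f' a)
    (h0 : f a = 0) (hf' : 0 < f') : ∀ᶠ y in 𝓝[>] a, 0 < f y := by
  have h1 := (hasDerivAt_iff_tendsto_slope.1 hf).eventually (lt_mem_nhds hf')
  have h2 : ∀ᶠ y in 𝓝[>] a, 0 < slope f a y :=
    h1.filter_mono (nhdsWithin_mono a fun y hy => ne_of_gt hy)
  filter_upwards [h2, self_mem_nhdsWithin] with y hy1 hy2
  rw [slope_def_field, h0, sub_zero] at hy1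
  have : 0 < y - a := sub_pos.2 hy2
  exact (div_pos_iff_of_pos_right this).1 hy1

variable {T : ℝ}

lemma IsC1Field.sub {f fx ft g gx gt : ℝ → ℝ → ℝ} (hf : IsC1Field T f fx ft)
    (hg : IsC1Field T g gx gt) :
    IsC1Field T (fun t x => f t x - g t x) (fun t x => fx t x - gx t x)
      (fun t x => ft t x - gt t x) where
  cont := hf.cont.sub hg.cont
  cont_x := hf.cont_x.sub hg.cont_x
  cont_t := hf.cont_t.sub hg.cont_t
  deriv_x t x := (hf.deriv_x t x).sub (hg.deriv_x t x)
  deriv_t t ht x := (hf.deriv_t t ht x).sub (hg.deriv_t t ht x)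

lemma IsC1Field.continuous_slice {f fx ft : ℝ → ℝ → ℝ} (hf : IsC1Field T f fx ft) (t : ℝ) :
    Continuous (f t) := hf.cont.comp (continuous_const.prodMk continuous_id)

lemma IsC1Field.continuous_slice_x {f fx ft : ℝ → ℝ → ℝ} (hf : IsC1Field T f fx ft) (t : ℝ) :
    Continuous (fx t) := hf.cont_x.comp (continuous_const.prodMk continuous_id)

lemma IsC1Field.continuous_slice_t {f fx ft : ℝ → ℝ → ℝ} (hf : IsC1Field T f fx ft) (t : ℝ) :
    Continuous (ft t) := hf.cont_t.comp (continuous_const.prodMk continuous_id)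

/-- Differentiation under the integral sign. -/
lemma IsC1Field.hasDerivAt_integral {f fx ft : ℝ → ℝ → ℝ} (hf : IsC1Field T f fx ft) {t : ℝ}
    (ht : t ∈ Ioo 0 T) (a b : ℝ) :
    HasDerivAt (fun s => ∫ x in a..b, f s x) (∫ x in a..b, ft t x) t := by
  obtain ⟨B, hB⟩ := ((isCompact_Icc (a := (0 : ℝ)) (b := T)).prod
    (isCompact_uIcc (a := a) (b := b))).exists_bound_of_continuousOn hf.cont_t.continuousOn
  refine (intervalIntegral.hasDerivAt_integral_of_dominated_loc_of_deriv_le (μ := volume)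
    (bound := fun _ => B) (F' := ft) (Ioo_mem_nhds ht.1 ht.2) ?_ ?_ ?_ ?_ ?_ ?_).2
  · exact Eventually.of_forall fun s => (hf.continuous_slice s).aestronglyMeasurable
  · exact (hf.continuous_slice t).intervalIntegrable _ _
  · exact (hf.continuous_slice_t t).aestronglyMeasurable
  · refine Eventually.of_forall fun x hx s hs => hB (s, x) ⟨Ioo_subset_Icc_self hs, ?_⟩
    exact uIoc_subset_uIcc hx
  · exact intervalIntegrable_const
  · exact Eventually.of_forall fun x _ s hs => hf.deriv_t s hs x

variable {ν γ : ℝ} {ρ ρx ρt u ux ut q qx qt b bx bt : ℝ → ℝ → ℝ}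

/-- The time derivative of the momentum of `[0,x]` relative to a reference velocity `b`. -/
lemma IsPointwiseSolution.hasDerivAt_relative_momentum
    (h : IsPointwiseSolution ν γ T ρ ρx ρt u ux ut q qx qt) (hb : IsC1Field T b bx bt) {t : ℝ}
    (ht : t ∈ Ioo 0 T) (hρ : ρ t 0 = 0) (hux : ux t 0 = 0) (x : ℝ) :
    HasDerivAt (fun s => ∫ y in (0 : ℝ)..x, ρ s y * (u s y - b s y))
      (ν * ux t x - ρ t x * u t x ^ 2 - (γ - 1) * q t x + ρ t x * u t x * b t x -
        ∫ y in (0 : ℝ)..x, ρ t y * (u t y * bx t y + bt t y)) t := by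
  have cρ := h.density.continuous_slice t
  have cρx := h.density.continuous_slice_x t
  have cρt := h.density.continuous_slice_t t
  have cu := h.velocity.continuous_slice t
  have cux := h.velocity.continuous_slice_x t
  have cut := h.velocity.continuous_slice_t t
  have cb := hb.continuous_slice t
  have cbx := hb.continuous_slice_x t
  have cbt := hb.continuous_slice_t t
  have h1 := (h.density.mul (h.velocity.sub hb)).hasDerivAt_integral ht 0 x
  convert h1 using 1
  have hm := h.momentum t ht 0 x
  -- Replacing `ρt` by `-(ρ u)ₓ` in the term `-ρt b` and completing the total derivative `(ρ u b)ₓ`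
  -- leaves the boundary flux and the integral of `ρ u bₓ`.
  have hflux : ∫ y in (0 : ℝ)..x, ((ρx t y * u t y + ρ t y * ux t y) * b t y +
      ρ t y * u t y * bx t y) = ρ t x * u t x * b t x - ρ t 0 * u t 0 * b t 0 := by
    refine intervalIntegral.integral_eq_sub_of_hasDerivAt (fun y _ =>
      (((h.density.deriv_x t y).fun_mul (h.velocity.deriv_x t y)).fun_mul (hb.deriv_x t y))) ?_
    exact Continuous.intervalIntegrable (by fun_prop) _ _
  have hsplit : ∫ y in (0 : ℝ)..x, (ρt t y * (u t y - b t y) + ρ t y * (ut t y - bt t y)) =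
      (∫ y in (0 : ℝ)..x, (ρt t y * u t y + ρ t y * ut t y)) +
      (∫ y in (0 : ℝ)..x, ((ρx t y * u t y + ρ t y * ux t y) * b t y + ρ t y * u t y * bx t y)) -
      ∫ y in (0 : ℝ)..x, ρ t y * (u t y * bx t y + bt t y) := by
    rw [← intervalIntegral.integral_add (Continuous.intervalIntegrable (by fun_prop) _ _)
      (Continuous.intervalIntegrable (by fun_prop) _ _),
      ← intervalIntegral.integral_sub (Continuous.intervalIntegrable (by fun_prop) _ _)
      (Continuous.intervalIntegrable (by fun_prop) _ _)]
    refine intervalIntegral.integral_congr fun y _ => ?_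
    have := h.mass t ht y
    linear_combination (-b t y) * this
  rw [hsplit, hm, hflux, hρ, hux, h.vacuum t 0 hρ]
  ring

/-- If the reference velocity dominates `u` initially and at the right end point and satisfies
the integrated differential inequality, then the relative momentum stays nonpositive. -/
lemma IsPointwiseSolution.relative_momentum_nonpos (hν : 0 < ν) (hγ : 1 ≤ γ)
    (h : IsPointwiseSolution ν γ T ρ ρx ρt u ux ut q qx qt) (hb : IsC1Field T b bx bt)
    {T' l : ℝ} (hT'T : T' < T) (hl : 0 < l)
    (hρ0 : ∀ t ∈ Ioo 0 T, ρ t 0 = 0) (hux0 : ∀ t ∈ Ioo 0 T, ux t 0 = 0)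
    (hq : ∀ t ∈ Icc 0 T', ∀ x, 0 ≤ q t x)
    (hρpos : ∀ t ∈ Icc 0 T', ∀ x ∈ Ioc 0 l, 0 < ρ t x) (hρi : ∀ x, 0 ≤ ρ 0 x)
    (hinitial : ∀ x ∈ Icc 0 l, u 0 x ≤ b 0 x) (hright : ∀ t ∈ Icc 0 T', u t l < b t l)
    (hineq : ∀ t ∈ Ioc 0 T', ∀ x ∈ Ioo 0 l,
      ν * bx t x ≤ ∫ y in (0 : ℝ)..x, ρ t y * (u t y * bx t y + bt t y))
    {t x : ℝ} (ht : t ∈ Icc 0 T') (hx : x ∈ Icc 0 l) :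
    ∫ y in (0 : ℝ)..x, ρ t y * (u t y - b t y) ≤ 0 := by
  set D : ℝ → ℝ → ℝ := fun t x => ∫ y in (0 : ℝ)..x, ρ t y * (u t y - b t y) with hD
  have hF := h.density.mul (h.velocity.sub hb)
  have hDc : Continuous (Function.uncurry D) := by
    have h1 : Continuous (Function.uncurry fun (p : ℝ × ℝ) y =>
        ρ p.1 y * (u p.1 y - b p.1 y)) :=
      hF.cont.comp ((continuous_fst.comp continuous_fst).prodMk continuous_snd)
    exact intervalIntegral.continuous_parametric_intervalIntegral_of_continuous h1 continuous_snd
  have hDx : ∀ t x, HasDerivAt (D t) (ρ t x * (u t x - b t x)) x := fun t x =>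
    intervalIntegral.integral_hasDerivAt_right ((hF.continuous_slice t).intervalIntegrable _ _)
      ((hF.continuous_slice t).stronglyMeasurableAtFilter _ _) (hF.continuous_slice t).continuousAt
  by_contra! hpos
  change 0 < D t x at hpos
  -- The penalty `κ t` leaves the maximum positive and turns the weak inequality for the time
  -- derivative into a strict one.
  obtain ⟨κ, hκ, hκt⟩ : ∃ κ > 0, κ * t < D t x := by
    refine ⟨D t x / (2 * (t + 1)), by have := ht.1; positivity, ?_⟩
    have := ht.1
    rw [div_mul_eq_mul_div, div_lt_iff₀ (by positivity)]
    nlinarith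
  obtain ⟨⟨t₀, x₀⟩, ⟨ht₀, hx₀⟩, hmax⟩ :=
    (isCompact_Icc (a := (0 : ℝ)) (b := T')).prod (isCompact_Icc (a := (0 : ℝ)) (b := l))
    |>.exists_isMaxOn ⟨(t, x), ht, hx⟩
      (f := fun p : ℝ × ℝ => D p.1 p.2 - κ * p.1)
      ((hDc.sub (continuous_const.mul continuous_fst)).continuousOn)
  simp only at ht₀ hx₀
  have hmax' : ∀ s ∈ Icc 0 T', ∀ y ∈ Icc 0 l, D s y - κ * s ≤ D t₀ x₀ - κ * t₀ :=
    fun s hs y hy => hmax (show (s, y) ∈ Icc 0 T' ×ˢ Icc 0 l from ⟨hs, hy⟩)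
  have hDpos : 0 < D t₀ x₀ := by
    have h1 := hmax' t ht x hx
    have h2 : 0 ≤ κ * t₀ := mul_nonneg hκ.le ht₀.1
    linarith
  have hx0 : 0 < x₀ := by
    refine lt_of_le_of_ne hx₀.1 fun h0 => ?_
    rw [← h0] at hDpos
    simp [hD] at hDpos
  have ht0 : 0 < t₀ := by
    refine lt_of_le_of_ne ht₀.1 fun h0 => ?_
    rw [← h0] at hDpos
    refine absurd hDpos (not_lt.2 ?_)
    have h1 : ∫ y in (0 : ℝ)..x₀, ρ 0 y * (u 0 y - b 0 y) ≤ ∫ y in (0 : ℝ)..x₀, (0 : ℝ) := by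
      refine intervalIntegral.integral_mono_on hx₀.1
        ((hF.continuous_slice 0).intervalIntegrable _ _) intervalIntegrable_const fun y hy => ?_
      exact mul_nonpos_of_nonneg_of_nonpos (hρi y)
        (sub_nonpos.2 (hinitial y ⟨hy.1, hy.2.trans hx₀.2⟩))
    simpa using h1
  -- At `x = l` the barrier is strictly above `u`, so `D` is strictly decreasing there.
  have hxl : x₀ < l := by
    refine lt_of_le_of_ne hx₀.2 fun h0 => ?_
    subst h0
    obtain ⟨y, hy, hlt⟩ := exists_lt_left_of_hasDerivAt_neg (hDx t₀ x₀)
      (mul_neg_of_pos_of_neg (hρpos t₀ ht₀ x₀ ⟨hx0, le_rfl⟩) (sub_neg.2 (hright t₀ ht₀))) hx0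
    linarith [hmax' t₀ ht₀ y ⟨hy.1.le, hy.2.le⟩]
  have htT : t₀ ∈ Ioo 0 T := ⟨ht0, ht₀.2.trans_lt hT'T⟩
  have hρ' := hρpos t₀ ht₀ x₀ ⟨hx0, hxl.le⟩
  -- Positivity of the density turns `Dₓ = 0` into `u = b`.
  have hub : u t₀ x₀ - b t₀ x₀ = 0 := by
    have hloc : IsLocalMax (D t₀) x₀ := by
      filter_upwards [Icc_mem_nhds hx0 hxl] with y hy
      linarith [hmax' t₀ ht₀ y hy]
    have := hloc.hasDerivAt_eq_zero (hDx t₀ x₀)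
    simpa [hρ'.ne'] using this
  -- This replaces a second-derivative test: otherwise `u > b` just to the right of `x₀`, and `D`
  -- would increase beyond its maximum.
  have hgrad : ux t₀ x₀ ≤ bx t₀ x₀ := by
    by_contra! hlt
    have h1 := eventually_pos_right_of_hasDerivAt_pos ((h.velocity.sub hb).deriv_x t₀ x₀) hub
      (sub_pos.2 hlt)
    obtain ⟨z, hz, hzs⟩ := (mem_nhdsGT_iff_exists_Ioo_subset' hxl).1 h1
    set w := min z l
    have hw : x₀ < w := lt_min hz hxl
    have h2 : 0 < ∫ y in x₀..w, ρ t₀ y * (u t₀ y - b t₀ y) :=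
      intervalIntegral.intervalIntegral_pos_of_pos_on
        ((hF.continuous_slice t₀).intervalIntegrable _ _) (fun y hy => mul_pos
          (hρpos t₀ ht₀ y ⟨hx0.trans hy.1, hy.2.le.trans (min_le_right _ _)⟩)
          (hzs ⟨hy.1, hy.2.trans_le (min_le_left _ _)⟩)) hw
    have h3 : D t₀ w - D t₀ x₀ = ∫ y in x₀..w, ρ t₀ y * (u t₀ y - b t₀ y) :=
      intervalIntegral.integral_interval_sub_left
        ((hF.continuous_slice t₀).intervalIntegrable _ _)
        ((hF.continuous_slice t₀).intervalIntegrable _ _)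
    linarith [hmax' t₀ ht₀ w ⟨(hx0.trans hw).le, min_le_right _ _⟩]
  have hDt := h.hasDerivAt_relative_momentum hb htT (hρ0 _ htT) (hux0 _ htT) x₀
  have hneg : ν * ux t₀ x₀ - ρ t₀ x₀ * u t₀ x₀ ^ 2 - (γ - 1) * q t₀ x₀ +
      ρ t₀ x₀ * u t₀ x₀ * b t₀ x₀ -
        (∫ y in (0 : ℝ)..x₀, ρ t₀ y * (u t₀ y * bx t₀ y + bt t₀ y)) - κ < 0 := by
    have h1 := hineq t₀ ⟨ht0, ht₀.2⟩ x₀ ⟨hx0, hxl⟩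
    have h2 : ν * ux t₀ x₀ ≤ ν * bx t₀ x₀ := by gcongr
    have h3 : 0 ≤ (γ - 1) * q t₀ x₀ := mul_nonneg (by linarith) (hq _ ht₀ _)
    -- At `u = b` the two convective terms cancel.
    have h4 : ρ t₀ x₀ * u t₀ x₀ * b t₀ x₀ = ρ t₀ x₀ * u t₀ x₀ ^ 2 := by
      rw [← sub_eq_zero.1 hub]; ring
    linarith
  -- Since `t₀` may be the final time `T'`, the comparison is with earlier times only.
  obtain ⟨s, hs, hlt⟩ := exists_lt_left_of_hasDerivAt_neg
    (hDt.sub (((hasDerivAt_id t₀).const_mul κ).congr_deriv (mul_one κ))) hneg ht0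
  have := hmax' s ⟨hs.1.le, hs.2.le.trans ht₀.2⟩ x₀ hx₀
  simp only [Pi.sub_apply, id] at hlt
  linarith

/-- The exponential barrier. -/
lemma isC1Field_barrier (T ε K a L : ℝ) :
    IsC1Field T (fun t x => ε * (1 - Real.exp (K * (x - a + L * t))))
      (fun t x => -(ε * K * Real.exp (K * (x - a + L * t))))
      (fun t x => -(ε * K * L * Real.exp (K * (x - a + L * t)))) where
  cont := by unfold Function.uncurry; fun_prop
  cont_x := by unfold Function.uncurry; fun_prop
  cont_t := by unfold Function.uncurry; fun_prop
  deriv_x t x := by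
    have h1 : HasDerivAt (fun x => K * (x - a + L * t)) K x := by
      simpa using (((hasDerivAt_id x).sub_const a).add_const (L * t)).const_mul K
    refine ((h1.exp.const_sub 1).const_mul ε).congr_deriv (by ring)
  deriv_t t _ x := by
    have h1 : HasDerivAt (fun t => K * (x - a + L * t)) (K * L) t := by
      simpa using (((hasDerivAt_id t).const_mul L).const_add (x - a)).const_mul K
    refine ((h1.exp.const_sub 1).const_mul ε).congr_deriv (by ring)

/-- The gain of `1 / K` lets a steep exponential absorb the nonlocal term of the differential
inequality into the local viscous one. -/
lemma integral_exp_barrier_le {K : ℝ} (hK : 0 < K) (c : ℝ) (x : ℝ) :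
    ∫ y in (0 : ℝ)..x, Real.exp (K * (y + c)) ≤ Real.exp (K * (x + c)) / K := by
  have : ∫ y in (0 : ℝ)..x, Real.exp (K * (y + c)) =
      Real.exp (K * (x + c)) / K - Real.exp (K * (0 + c)) / K := by
    refine intervalIntegral.integral_eq_sub_of_hasDerivAt
      (f := fun y => Real.exp (K * (y + c)) / K) (fun y _ => ?_)
      (Continuous.intervalIntegrable (by fun_prop) _ _)
    have h1 : HasDerivAt (fun y => K * (y + c)) K y := by
      simpa using ((hasDerivAt_id y).add_const c).const_mul K
    exact (h1.exp.div_const K).congr_deriv (by field_simp)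
  rw [this]
  have := div_pos (Real.exp_pos (K * (0 + c))) hK
  linarith

/-- A velocity pointing out of the gas next to the left vacuum boundary is impossible. -/
theorem IsPointwiseSolution.false_of_left (hν : 0 < ν) (hγ : 1 ≤ γ) (hT : 0 < T)
    (h : IsPointwiseSolution ν γ T ρ ρx ρt u ux ut q qx qt)
    (hvac : ∀ x, x ∉ Ioo 0 1 → ρ 0 x = 0) (hpos : ∀ x ∈ Ioo 0 1, 0 < ρ 0 x)
    (hq0 : ∀ x, 0 ≤ q 0 x) {l : ℝ} (hl : l ∈ Ioo 0 1) (hul : u 0 l < 0)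
    (hu : ∀ x ∈ Ioo 0 l, u 0 x ≤ 0) : False := by
  obtain ⟨C, hC⟩ := h.bound
  have hC0 : 0 ≤ C := (abs_nonneg _).trans (hC 0 0).1
  have hρi : ∀ x, 0 ≤ ρ 0 x := fun x => by
    by_cases hx : x ∈ Ioo 0 1
    exacts [(hpos x hx).le, (hvac x hx).ge]
  obtain ⟨hρv, huv, hchar⟩ := h.vacuum_left hν hT fun x hx => hvac x fun h' => by linarith [h'.1]
  have hu0 : ∀ t ∈ Icc 0 T, u t 0 = 0 := fun t ht =>
    (hchar t ht).unique (hasDerivAt_const t 0)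
  have hl0 := hl.1
  obtain ⟨c, hc, hcl⟩ : ∃ c > 0, u 0 l < -c := ⟨-u 0 l / 2, by linarith, by linarith⟩
  obtain ⟨δ, hδ, hδu⟩ : ∃ δ > 0, ∀ t x, |t| < δ → |x - l| < δ → u t x < -c := by
    have h1 : ∀ᶠ p in 𝓝 ((0 : ℝ), l), Function.uncurry u p < -c :=
      h.velocity.cont.continuousAt.eventually (gt_mem_nhds hcl)
    obtain ⟨δ, hδ, hsub⟩ := Metric.eventually_nhds_iff.1 h1
    refine ⟨δ, hδ, fun t x ht hx => hsub (y := (t, x)) ?_⟩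
    rw [Prod.dist_eq, Real.dist_eq, Real.dist_eq]
    simpa using ⟨ht, hx⟩
  -- This keeps `a` positive and places `[a, l]` where `u < -c` for short times.
  set a := max (l / 2) (l - δ / 2) with ha
  have ha0 : 0 < a := lt_of_lt_of_le (by linarith) (le_max_left _ _)
  have hal : a < l := max_lt (by linarith) (by linarith)
  have haδ : l - δ / 2 ≤ a := le_max_right _ _
  obtain ⟨T', hT'0, hT'δ, hT'T, hT'C⟩ : ∃ T' > 0, T' < δ ∧ T' < T ∧ l + C * T' < 1 := by
    have h1 : ∀ᶠ s in 𝓝[>] (0 : ℝ), s < δ := nhdsWithin_le_nhds (gt_mem_nhds hδ)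
    have h2 : ∀ᶠ s in 𝓝[>] (0 : ℝ), s < T := nhdsWithin_le_nhds (gt_mem_nhds hT)
    have h3 : ∀ᶠ s in 𝓝[>] (0 : ℝ), l + C * s < 1 := by
      have hcont : Continuous fun s => l + C * s := by fun_prop
      exact nhdsWithin_le_nhds (hcont.continuousAt.eventually (gt_mem_nhds (by simpa using hl.2)))
    obtain ⟨s, ⟨⟨hs1, hs2⟩, hs3⟩, hs4⟩ :=
      (((h1.and h2).and h3).and (self_mem_nhdsWithin : Ioi (0 : ℝ) ∈ _)).exists
    exact ⟨s, hs4, hs1, hs2, hs3⟩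
  -- The zero `a - L t` of the barrier reaches `-a` at time `T'`, so the barrier is then negative at
  -- the origin.
  set L := 2 * a / T' with hL
  have hLpos : 0 < L := by positivity
  have hLT : L * T' = 2 * a := by rw [hL]; field_simp
  -- This makes `C (C + L) / K ≤ ν`; the summand `1` ensures `K > 0` even if `C = 0`.
  set K := (C * (C + L) + 1) / ν with hK
  have hKpos : 0 < K := by positivity
  -- With this amplitude the smallest value of the barrier for `x ≤ l`, `t ≤ T'` is `ε - c`, which
  -- is above `-c`.
  set ε := c * Real.exp (-(K * (l - a + L * T'))) with hε
  have hεpos : 0 < ε := by positivity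
  have hbar := isC1Field_barrier T ε K a L
  have hblow : ∀ t ≤ T', ∀ x ≤ l, -c < ε * (1 - Real.exp (K * (x - a + L * t))) := by
    intro t ht x hx
    have h1 : Real.exp (K * (x - a + L * t)) ≤ Real.exp (K * (l - a + L * T')) := by gcongr
    have h2 : ε * Real.exp (K * (l - a + L * T')) = c := by
      rw [hε, mul_assoc, ← Real.exp_add]; simp
    have h3 := mul_le_mul_of_nonneg_left h1 hεpos.le
    linarith
  have hρpos : ∀ t ∈ Icc 0 T', ∀ x ∈ Ioc 0 l, 0 < ρ t x := fun t ht x hx =>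
    h.density_pos hchar hpos (fun t x => (hC t x).2.1) ⟨ht.1, ht.2.trans hT'T.le⟩
      (by nlinarith [ht.2]) hx.1 hx.2
  have key := fun x (hx : x ∈ Icc 0 l) => h.relative_momentum_nonpos hν hγ hbar hT'T hl0
    (fun t ht => hρv t (Ioo_subset_Icc_self ht) 0 le_rfl)
    (fun t ht => h.gradient_zero_left (huv t ht))
    (fun t ht x => h.internal_nonneg hν.le hq0 ⟨ht.1, ht.2.trans hT'T.le⟩ x)
    hρpos hρi ?_ ?_ ?_ ⟨hT'0.le, le_rfl⟩ hx
  · have hpos0 : 0 < u T' 0 - ε * (1 - Real.exp (K * (0 - a + L * T'))) := by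
      rw [hu0 T' ⟨hT'0.le, hT'T.le⟩, hLT]
      have : 1 < Real.exp (K * (0 - a + 2 * a)) := Real.one_lt_exp_iff.2 (by
        have := mul_pos hKpos ha0
        linarith)
      nlinarith
    have hcont : Continuous fun x => u T' x - ε * (1 - Real.exp (K * (x - a + L * T'))) :=
      (h.velocity.continuous_slice T').sub (hbar.continuous_slice T')
    have hev : ∀ᶠ x in 𝓝[>] (0 : ℝ), 0 < u T' x - ε * (1 - Real.exp (K * (x - a + L * T'))) :=
      nhdsWithin_le_nhds (hcont.continuousAt.eventually (lt_mem_nhds hpos0))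
    obtain ⟨z, hz, hzs⟩ := (mem_nhdsGT_iff_exists_Ioo_subset' hl0).1 hev
    have hw : 0 < min z l := lt_min hz hl0
    refine absurd (key (min z l) ⟨hw.le, min_le_right _ _⟩) (not_le.2 ?_)
    refine intervalIntegral.intervalIntegral_pos_of_pos_on
      (((h.density.continuous_slice T').mul hcont).intervalIntegrable _ _)
      (fun y hy => mul_pos ?_ (hzs ⟨hy.1, hy.2.trans_le (min_le_left _ _)⟩)) hw
    exact hρpos T' ⟨hT'0.le, le_rfl⟩ y ⟨hy.1, hy.2.le.trans (min_le_right _ _)⟩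
  · intro x hx
    -- Up to `a` the initial barrier is nonnegative and `u ≤ 0`; beyond `a` one has `u < -c`, which
    -- is below the barrier.
    rcases le_or_gt x a with hxa | hxa
    · have h1 : u 0 x ≤ 0 := by
        rcases eq_or_lt_of_le hx.1 with rfl | h0
        · exact (hu0 0 ⟨le_rfl, hT.le⟩).le
        · exact hu x ⟨h0, hxa.trans_lt hal⟩
      have h2 : Real.exp (K * (x - a + L * 0)) ≤ 1 := Real.exp_le_one_iff.2 (by nlinarith)
      exact h1.trans (mul_nonneg hεpos.le (by linarith))
    · refine ((hδu 0 x (by simpa using hδ) ?_).trans (hblow 0 hT'0.le x hx.2)).le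
      rw [abs_lt]; constructor <;> linarith [hx.2]
  · intro t ht
    refine (hδu t l ?_ (by simpa using hδ)).trans (hblow t ht.2 l le_rfl)
    rw [abs_of_nonneg ht.1]; exact ht.2.trans_lt hT'δ
  · intro t ht x hx
    have htT : t ∈ Icc 0 T := ⟨ht.1.le, ht.2.trans hT'T.le⟩
    have cρ := h.density.continuous_slice t
    have cu := h.velocity.continuous_slice t
    -- Since `b_t = L bₓ`, the integrand is `ρ (u + L) bₓ`, and bounding `ρ (u + L)` by `C (C + L)`
    -- leaves a pure exponential.
    have h1 : ∫ y in (0 : ℝ)..x, ρ t y * (u t y + L) * Real.exp (K * (y + (-a + L * t))) ≤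
        ∫ y in (0 : ℝ)..x, C * (C + L) * Real.exp (K * (y + (-a + L * t))) := by
      refine intervalIntegral.integral_mono_on hx.1.le
        (Continuous.intervalIntegrable (by fun_prop) _ _)
        (Continuous.intervalIntegrable (by fun_prop) _ _) fun y _ => ?_
      have h3 := h.density_nonneg hρi htT y
      have h4 := (abs_le.1 (hC t y).1).2
      have h5 := (abs_le.1 (hC t y).2.1).2
      refine mul_le_mul_of_nonneg_right ?_ (Real.exp_pos _).le
      calc ρ t y * (u t y + L) ≤ ρ t y * (C + L) := by gcongr
        _ ≤ C * (C + L) := by gcongr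
    rw [intervalIntegral.integral_const_mul] at h1
    have h2 := integral_exp_barrier_le hKpos (-a + L * t) x
    have h6 : C * (C + L) * (∫ y in (0 : ℝ)..x, Real.exp (K * (y + (-a + L * t)))) ≤
        ν * Real.exp (K * (x + (-a + L * t))) := by
      calc _ ≤ C * (C + L) * (Real.exp (K * (x + (-a + L * t))) / K) := by gcongr
        _ = (C * (C + L) / K) * Real.exp (K * (x + (-a + L * t))) := by ring
        _ ≤ _ := by
          gcongr
          rw [div_le_iff₀ hKpos, hK, mul_div_cancel₀ _ hν.ne']
          linarith
    have h7 : ∫ y in (0 : ℝ)..x, ρ t y * (u t y * -(ε * K * Real.exp (K * (y - a + L * t))) +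
        -(ε * K * L * Real.exp (K * (y - a + L * t)))) = -(ε * K) *
        ∫ y in (0 : ℝ)..x, ρ t y * (u t y + L) * Real.exp (K * (y + (-a + L * t))) := by
      rw [← intervalIntegral.integral_const_mul]
      refine intervalIntegral.integral_congr fun y _ => ?_
      have : y - a + L * t = y + (-a + L * t) := by ring
      simp only [this]
      ring
    rw [h7, show x - a + L * t = x + (-a + L * t) by ring]
    have h8 := mul_le_mul_of_nonneg_left (h1.trans h6) (mul_pos hεpos hKpos).le
    linarith

end Comparison

/-! ### Reduction of the right boundary to the left one. -/

section Reflection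

variable {ν γ T : ℝ} {ρ ρx ρt u ux ut q qx qt : ℝ → ℝ → ℝ}

lemma IsC1Field.reflect {f fx ft : ℝ → ℝ → ℝ} (hf : IsC1Field T f fx ft) :
    IsC1Field T (fun t x => f t (1 - x)) (fun t x => -fx t (1 - x)) (fun t x => ft t (1 - x)) where
  cont := hf.cont.comp (continuous_fst.prodMk (continuous_const.sub continuous_snd))
  cont_x := (hf.cont_x.comp (continuous_fst.prodMk (continuous_const.sub continuous_snd))).neg
  cont_t := hf.cont_t.comp (continuous_fst.prodMk (continuous_const.sub continuous_snd))
  deriv_x t x := (hf.deriv_x t (1 - x)).comp_const_sub 1 x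
  deriv_t t ht x := hf.deriv_t t ht (1 - x)

lemma IsC1Field.neg {f fx ft : ℝ → ℝ → ℝ} (hf : IsC1Field T f fx ft) :
    IsC1Field T (fun t x => -f t x) (fun t x => -fx t x) (fun t x => -ft t x) where
  cont := hf.cont.neg
  cont_x := hf.cont_x.neg
  cont_t := hf.cont_t.neg
  deriv_x t x := (hf.deriv_x t x).neg
  deriv_t t ht x := (hf.deriv_t t ht x).neg

/-- The equations are invariant under the reflection `x ↦ 1 - x`, `u ↦ -u`. -/
lemma IsPointwiseSolution.reflect (h : IsPointwiseSolution ν γ T ρ ρx ρt u ux ut q qx qt) :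
    IsPointwiseSolution ν γ T (fun t x => ρ t (1 - x)) (fun t x => -ρx t (1 - x))
      (fun t x => ρt t (1 - x)) (fun t x => -u t (1 - x)) (fun t x => ux t (1 - x))
      (fun t x => -ut t (1 - x)) (fun t x => q t (1 - x)) (fun t x => -qx t (1 - x))
      (fun t x => qt t (1 - x)) where
  density := h.density.reflect
  velocity := by simpa using h.velocity.reflect.neg
  internal := h.internal.reflect
  bound := by
    obtain ⟨C, hC⟩ := h.bound
    exact ⟨C, fun t x => by simpa using hC t (1 - x)⟩
  memLp t := ((h.memLp t).comp_measurePreserving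
    (Measure.measurePreserving_sub_left volume (1 : ℝ))).neg
  vacuum t x hx := h.vacuum t (1 - x) hx
  mass t ht x := by linarith [h.mass t ht (1 - x)]
  energy t ht x := by linarith [h.energy t ht (1 - x)]
  momentum t ht a b := by
    have h1 := h.momentum t ht (1 - b) (1 - a)
    have h2 := intervalIntegral.integral_comp_sub_left (a := a) (b := b)
      (fun x => ρt t x * u t x + ρ t x * ut t x) 1
    rw [h1] at h2
    calc _ = ∫ x in a..b, -(ρt t (1 - x) * u t (1 - x) + ρ t (1 - x) * ut t (1 - x)) :=
          intervalIntegral.integral_congr fun x _ => by ring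
      _ = _ := by rw [intervalIntegral.integral_neg, h2]; ring

/-- A velocity pointing out of the gas next to the right vacuum boundary is impossible. -/
theorem IsPointwiseSolution.false_of_right (hν : 0 < ν) (hγ : 1 ≤ γ) (hT : 0 < T)
    (h : IsPointwiseSolution ν γ T ρ ρx ρt u ux ut q qx qt)
    (hvac : ∀ x, x ∉ Ioo 0 1 → ρ 0 x = 0) (hpos : ∀ x ∈ Ioo 0 1, 0 < ρ 0 x)
    (hq0 : ∀ x, 0 ≤ q 0 x) {l : ℝ} (hl : l ∈ Ioo 0 1) (hul : 0 < u 0 l)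
    (hu : ∀ x ∈ Ioo l 1, 0 ≤ u 0 x) : False := by
  refine h.reflect.false_of_left hν hγ hT (l := 1 - l) (fun x hx => hvac _ fun hx' => hx ?_)
    (fun x hx => hpos _ ?_) (fun x => hq0 _) ?_ ?_ fun x hx => ?_
  · constructor <;> linarith [hx'.1, hx'.2]
  · constructor <;> linarith [hx.1, hx.2]
  · constructor <;> linarith [hl.1, hl.2]
  · simpa using hul
  · have := hu (1 - x) (by constructor <;> linarith [hx.1, hx.2])
    linarith

end Reflection

/-! ### Fourier description of `H^m` and of derivatives of its elements. -/

open FourierTransform ENNReal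
open scoped BoundedContinuousFunction

section Sobolev

lemma memLp_two_japanese {s : ℝ} (hs : 1 < 2 * s) :
    MemLp (fun ξ : ℝ => (1 + ‖ξ‖ ^ 2) ^ (-s / 2)) 2 volume := by
  have hc : Continuous fun ξ : ℝ => (1 + ‖ξ‖ ^ 2) ^ (-s / 2) :=
    Continuous.rpow_const (by fun_prop) fun ξ => Or.inl (by positivity)
  refine (memLp_two_iff_integrable_sq hc.aestronglyMeasurable).2 ?_
  have := integrable_rpow_neg_one_add_norm_sq (E := ℝ) (μ := volume) (r := 2 * s) (by simpa using hs)
  refine this.congr (Eventually.of_forall fun ξ => ?_)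
  simp only
  rw [← Real.rpow_mul_natCast (by positivity)]
  congr 1
  push_cast
  ring

/-- The symbol `(2πiξ)^k (1 + |ξ|²)^{-m/2}` of the `k`-th derivative of the Bessel potential of
order `-m`. -/
noncomputable def besselSymbol (m : ℝ) (k : ℕ) (ξ : ℝ) : ℂ :=
  (2 * Real.pi * Complex.I * ξ) ^ k * (((1 + ‖ξ‖ ^ 2) ^ (-m / 2) : ℝ) : ℂ)

lemma besselSymbol_succ (m : ℝ) (k : ℕ) (ξ : ℝ) :
    besselSymbol m (k + 1) ξ = 2 * Real.pi * Complex.I * ξ * besselSymbol m k ξ := by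
  simp only [besselSymbol, pow_succ]; ring

lemma besselSymbol_zero (m : ℝ) :
    besselSymbol m 0 = fun ξ : ℝ => (((1 + ‖ξ‖ ^ 2) ^ (-m / 2) : ℝ) : ℂ) := by
  ext ξ; simp [besselSymbol]

lemma hasTemperateGrowth_besselSymbol (m : ℝ) (k : ℕ) : (besselSymbol m k).HasTemperateGrowth := by
  unfold besselSymbol
  fun_prop

/-- Each derivative costs one power of `(1 + |ξ|²)^{1/2}`. -/
lemma norm_besselSymbol_le (m : ℝ) (k : ℕ) (ξ : ℝ) :
    ‖besselSymbol m k ξ‖ ≤ (2 * Real.pi) ^ k * (1 + ‖ξ‖ ^ 2) ^ (-(m - k) / 2) := by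
  have h1 : ‖ξ‖ ≤ (1 + ‖ξ‖ ^ 2) ^ (1 / 2 : ℝ) := by
    rw [← Real.sqrt_eq_rpow]
    exact Real.le_sqrt_of_sq_le (by linarith)
  have h2 : ‖ξ‖ ^ k ≤ (1 + ‖ξ‖ ^ 2) ^ ((k : ℝ) / 2) := by
    refine (pow_le_pow_left₀ (norm_nonneg _) h1 k).trans_eq ?_
    rw [← Real.rpow_mul_natCast (by positivity)]
    congr 1; ring
  have h3 : (1 + ‖ξ‖ ^ 2) ^ (-(m - k) / 2) =
      (1 + ‖ξ‖ ^ 2) ^ ((k : ℝ) / 2) * (1 + ‖ξ‖ ^ 2) ^ (-m / 2) := by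
    rw [← Real.rpow_add (by positivity)]; congr 1; ring
  have h4 : ‖(2 * Real.pi * Complex.I * ξ : ℂ)‖ = 2 * Real.pi * ‖ξ‖ := by
    simp [abs_of_pos Real.pi_pos]
  have h5 : ‖(((1 + ‖ξ‖ ^ 2) ^ (-m / 2) : ℝ) : ℂ)‖ = (1 + ‖ξ‖ ^ 2) ^ (-m / 2) := by
    rw [Complex.norm_real]
    exact Real.norm_of_nonneg (by positivity)
  rw [besselSymbol, norm_mul, norm_pow, h4, h3, h5, mul_pow, mul_assoc]
  gcongr

lemma memLp_two_besselSymbol {m : ℝ} {k : ℕ} (h : 1 < 2 * (m - k)) :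
    MemLp (besselSymbol m k) 2 volume := by
  refine (memLp_two_japanese h).of_le_mul (c := (2 * Real.pi) ^ k)
    (hasTemperateGrowth_besselSymbol m k).1.continuous.aestronglyMeasurable
    (Eventually.of_forall fun ξ => ?_)
  rw [Real.norm_of_nonneg (by positivity)]
  exact norm_besselSymbol_le m k ξ

/-- Needed for the second derivative, whose symbol is not in `L²` when `2 < m ≤ 5/2`. -/
lemma memLp_top_besselSymbol {m : ℝ} {k : ℕ} (h : (k : ℝ) ≤ m) :
    MemLp (besselSymbol m k) ∞ volume := by
  refine memLp_top_of_bound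
    (hasTemperateGrowth_besselSymbol m k).1.continuous.aestronglyMeasurable ((2 * Real.pi) ^ k)
    (Eventually.of_forall fun ξ => (norm_besselSymbol_le m k ξ).trans ?_)
  refine mul_le_of_le_one_right (by positivity) ?_
  exact Real.rpow_le_one_of_one_le_of_nonpos (by simp [sq_nonneg]) (by linarith)

/-- The inverse Fourier transform of `w G` for `w, G ∈ L²`, as a bounded continuous function. -/
noncomputable def invFourierMul (w : Lp ℂ 2 (volume : Measure ℝ)) :
    Lp ℂ 2 (volume : Measure ℝ) →L[ℂ] (ℝ →ᵇ ℂ) :=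
  Real.Lp.fourierTransformInvCLM ℝ ℂ ∘L
    (ContinuousLinearMap.holderL volume 2 2 1 (ContinuousLinearMap.mul ℂ ℂ) w)

lemma invFourierMul_toLp_apply {w : ℝ → ℂ} (hw : MemLp w 2 volume)
    (G : Lp ℂ 2 (volume : Measure ℝ)) (x : ℝ) :
    invFourierMul (hw.toLp w) G x = 𝓕⁻ (fun ξ => w ξ * G ξ) x := by
  simp only [invFourierMul, ContinuousLinearMap.comp_apply, Real.Lp.fourierTransformInvCLM_apply,
    Real.Lp.fourierTransformInv_apply]
  refine Real.fourierInv_congr_ae ?_ x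
  filter_upwards [ContinuousLinearMap.coeFn_holder (r := 1) (ContinuousLinearMap.mul ℂ ℂ)
    (hw.toLp w) G, hw.coeFn_toLp] with ξ h1 h2
  refine h1.trans ?_
  simp [h2]

lemma integrable_mul_of_memLp_two {w : ℝ → ℂ} (hw : MemLp w 2 volume)
    (G : Lp ℂ 2 (volume : Measure ℝ)) : Integrable (fun ξ => w ξ * G ξ) :=
  hw.integrable_mul (Lp.memLp G)

lemma hasDerivAt_fourierInv {f : ℝ → ℂ} (hf : Integrable f)
    (hf' : Integrable fun ξ : ℝ => 2 * Real.pi * Complex.I * ξ * f ξ) (x : ℝ) :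
    HasDerivAt (𝓕⁻ f) (𝓕⁻ (fun ξ : ℝ => 2 * Real.pi * Complex.I * ξ * f ξ) x) x := by
  have h1 : Integrable fun ξ : ℝ => ξ • f ξ := by
    refine (hf'.const_mul (2 * Real.pi * Complex.I)⁻¹).congr (Eventually.of_forall fun ξ => ?_)
    have : (2 * Real.pi * Complex.I : ℂ) ≠ 0 := by simp [Real.pi_ne_zero]
    simp only [Complex.real_smul]
    field_simp
  have h2 := (Real.hasDerivAt_fourier hf h1 (-x)).scomp x (hasDerivAt_neg x)
  have h3 : (𝓕⁻ f : ℝ → ℂ) = 𝓕 f ∘ Neg.neg := by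
    ext y; exact Real.fourierInv_eq_fourier_neg f y
  rw [h3]
  refine h2.congr_deriv ?_
  rw [Real.fourierInv_eq_fourier_neg, Real.fourier_real_eq, Real.fourier_real_eq, ← integral_smul]
  refine integral_congr_ae (Eventually.of_forall fun ξ => ?_)
  simp only [smul_eq_mul, neg_smul, one_smul, Circle.smul_def]
  ring

lemma hasDerivAt_invFourierMul {m : ℝ} {k : ℕ} (hk : MemLp (besselSymbol m k) 2 volume)
    (hk' : MemLp (besselSymbol m (k + 1)) 2 volume) (G : Lp ℂ 2 (volume : Measure ℝ)) (x : ℝ) :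
    HasDerivAt (invFourierMul (hk.toLp _) G) (invFourierMul (hk'.toLp _) G x) x := by
  have h1 : (invFourierMul (hk.toLp _) G : ℝ → ℂ) = 𝓕⁻ (fun ξ => besselSymbol m k ξ * G ξ) := by
    ext y; exact invFourierMul_toLp_apply hk G y
  have h2 : (fun ξ => besselSymbol m (k + 1) ξ * G ξ) =
      fun ξ : ℝ => 2 * Real.pi * Complex.I * ξ * (besselSymbol m k ξ * G ξ) := by
    ext ξ; rw [besselSymbol_succ]; ring
  rw [h1, invFourierMul_toLp_apply, h2]
  refine hasDerivAt_fourierInv (integrable_mul_of_memLp_two hk G) ?_ x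
  rw [← h2]
  exact integrable_mul_of_memLp_two hk' G

/-- Multiplication by a bounded function on `L²`. -/
noncomputable def mulBounded (w : Lp ℂ ∞ (volume : Measure ℝ)) :
    Lp ℂ 2 (volume : Measure ℝ) →L[ℂ] Lp ℂ 2 (volume : Measure ℝ) :=
  ContinuousLinearMap.holderL volume ∞ 2 2 (ContinuousLinearMap.mul ℂ ℂ) w

/-- Identifies the `L²` multiplier on a dense subspace, where the Fourier integrals are classical.
-/
lemma mulBounded_toLp_schwartz {w : ℝ → ℂ} (hw : MemLp w ∞ volume) (hg : w.HasTemperateGrowth)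
    (φ : 𝓢(ℝ, ℂ)) :
    mulBounded (hw.toLp w) (φ.toLp 2) = (SchwartzMap.smulLeftCLM ℂ w φ).toLp 2 := by
  refine Lp.ext ?_
  filter_upwards [ContinuousLinearMap.coeFn_holder (r := 2) (ContinuousLinearMap.mul ℂ ℂ)
    (hw.toLp w) (φ.toLp 2), hw.coeFn_toLp, φ.coeFn_toLp 2,
    (SchwartzMap.smulLeftCLM ℂ w φ).coeFn_toLp 2] with ξ h1 h2 h3 h4
  refine h1.trans ?_
  rw [h4, h2, h3]
  simp [hg]

/-- The first derivative is a primitive of the `L²` inverse Fourier transform of the symbol of the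
second one. -/
lemma invFourierMul_sub_eq_integral {m : ℝ} {k : ℕ} (hk : MemLp (besselSymbol m k) 2 volume)
    (hk' : MemLp (besselSymbol m (k + 1)) ∞ volume) (G : Lp ℂ 2 (volume : Measure ℝ)) {a b : ℝ}
    (hab : a ≤ b) :
    invFourierMul (hk.toLp _) G b - invFourierMul (hk.toLp _) G a =
      ∫ x in Ioc a b, (𝓕⁻ (mulBounded (hk'.toLp _) G) : Lp ℂ 2 (volume : Measure ℝ)) x := by
  have hfin : volume (Ioc a b) ≠ ∞ := by simp
  -- As a pairing with an indicator function the right side is continuous in `G` for the `L²` norm,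
  -- so it suffices to take `G` Schwartz.
  simp_rw [← L2.inner_indicatorConstLp_one (𝕜 := ℂ) measurableSet_Ioc hfin]
  refine DenseRange.induction_on (e := SchwartzMap.toLpCLM ℂ (E := ℝ) ℂ 2 volume)
    (SchwartzMap.denseRange_toLpCLM ENNReal.ofNat_ne_top) G ?_ fun φ => ?_
  · refine isClosed_eq ?_ ?_
    · exact ((continuous_eval_const _).comp
        (invFourierMul (hk.toLp _)).continuous).sub
        ((continuous_eval_const _).comp
        (invFourierMul (hk.toLp _)).continuous)
    · exact continuous_const.inner (((Lp.fourierTransformₗᵢ ℝ ℂ).symm.continuous).comp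
        (mulBounded (hk'.toLp _)).continuous)
  · rw [L2.inner_indicatorConstLp_one]
    have hT := hasTemperateGrowth_besselSymbol m (k + 1)
    have e1 : (𝓕⁻ (mulBounded (hk'.toLp _) (φ.toLp 2)) : Lp ℂ 2 (volume : Measure ℝ)) =
        (𝓕⁻ (SchwartzMap.smulLeftCLM ℂ (besselSymbol m (k + 1)) φ)).toLp 2 := by
      rw [mulBounded_toLp_schwartz hk' hT, SchwartzMap.toLp_fourierInv_eq]
    have e2 : SchwartzMap.toLpCLM ℂ (E := ℝ) ℂ 2 volume φ = φ.toLp 2 := rfl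
    set ψ := SchwartzMap.smulLeftCLM ℂ (besselSymbol m (k + 1)) φ with hψ
    have hψ' : ∀ ξ : ℝ, ψ ξ = 2 * Real.pi * Complex.I * ξ * (besselSymbol m k ξ * φ ξ) := fun ξ => by
      rw [hψ, SchwartzMap.smulLeftCLM_apply_apply hT, besselSymbol_succ, smul_eq_mul]; ring
    have hψf : (ψ : ℝ → ℂ) =
        fun ξ : ℝ => 2 * Real.pi * Complex.I * ξ * (besselSymbol m k ξ * φ ξ) := funext hψ'
    have e3 : ∀ x, invFourierMul (hk.toLp _) (φ.toLp 2) x =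
        𝓕⁻ (fun ξ => besselSymbol m k ξ * φ ξ) x := fun x => by
      rw [invFourierMul_toLp_apply]
      refine Real.fourierInv_congr_ae ?_ x
      filter_upwards [φ.coeFn_toLp 2] with ξ hξ
      rw [hξ]
    have hintegrable : Integrable fun ξ => besselSymbol m k ξ * φ ξ :=
      (integrable_mul_of_memLp_two hk (φ.toLp 2)).congr <| by
        filter_upwards [φ.coeFn_toLp 2] with ξ hξ
        rw [hξ]
    rw [e2, e1, e3, e3, ← intervalIntegral.integral_of_le hab]
    have e4 : ∫ x in a..b, ((𝓕⁻ ψ).toLp 2 : Lp ℂ 2 (volume : Measure ℝ)) x =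
        ∫ x in a..b, (𝓕⁻ ψ) x := by
      refine intervalIntegral.integral_congr_ae ?_
      filter_upwards [(𝓕⁻ ψ).coeFn_toLp 2] with x hx _
      exact hx
    rw [e4]
    symm
    refine intervalIntegral.integral_eq_sub_of_hasDerivAt (fun x _ => ?_)
      ((𝓕⁻ ψ).continuous.intervalIntegrable _ _)
    have := hasDerivAt_fourierInv hintegrable (by rw [← hψf]; exact ψ.integrable) x
    rw [← hψf] at this
    rwa [SchwartzMap.fourierInv_coe]

/-- Two continuous functions that define the same tempered distribution are equal. -/
lemma eq_of_forall_integral_schwartz_eq {f g : ℝ → ℂ} (hf : Continuous f) (hg : Continuous g)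
    (h : ∀ φ : 𝓢(ℝ, ℂ), ∫ x, φ x * f x = ∫ x, φ x * g x) : f = g := by
  refine (Continuous.ae_eq_iff_eq volume hf hg).1 ?_
  refine ae_eq_of_integral_contDiff_smul_eq hf.locallyIntegrable hg.locallyIntegrable
    fun φ hφ hφc => ?_
  have h1 : HasCompactSupport (Complex.ofRealCLM ∘ φ) := hφc.comp_left rfl
  have h2 : ContDiff ℝ (⊤ : ℕ∞) (Complex.ofRealCLM ∘ φ) := by fun_prop
  simpa using h (h1.toSchwartzMap h2)

/-- The continuous representative is the inverse Fourier integral. -/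
lemma HasBesselLift.eq_invFourierMul {m : ℝ} {f : ℝ → ℝ} {g : Lp ℂ 2 (volume : Measure ℝ)}
    (h : HasBesselLift m f g) (hw : MemLp (besselSymbol m 0) 2 volume) (x : ℝ) :
    (f x : ℂ) = invFourierMul (hw.toLp _) (𝓕 g) x := by
  obtain ⟨hfc, hf, hB⟩ := h
  have hB' := (TemperedDistribution.besselPotential_neg_apply_eq_iff m _ _).2 hB
  refine congrFun (eq_of_forall_integral_schwartz_eq (f := fun x => (f x : ℂ))
    (g := invFourierMul (hw.toLp _) (𝓕 g)) (by fun_prop)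
    (invFourierMul (hw.toLp _) (𝓕 g)).continuous fun φ => ?_) x
  have h1 := congrArg (fun S : 𝓢'(ℝ, ℂ) => S φ) hB'
  simp only [TemperedDistribution.besselPotential,
    TemperedDistribution.fourierMultiplierCLM_apply_apply] at h1
  rw [← TemperedDistribution.fourier_apply, Lp.fourier_toTemperedDistribution_eq,
    Lp.toTemperedDistribution_apply, Lp.toTemperedDistribution_apply] at h1
  have e1 : ∫ x, φ x * (f x : ℂ) = ∫ x, φ x • (hf.toLp _ : Lp ℂ 2 (volume : Measure ℝ)) x := by
    refine integral_congr_ae ?_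
    filter_upwards [hf.coeFn_toLp] with x hx
    rw [hx, smul_eq_mul]
  have hsym : (fun ξ : ℝ => (((1 + ‖ξ‖ ^ 2) ^ (-m / 2) : ℝ) : ℂ)) = besselSymbol m 0 :=
    (besselSymbol_zero m).symm
  rw [e1, ← h1, hsym]
  have e2 : ∀ x, invFourierMul (hw.toLp _) (𝓕 g) x =
      𝓕⁻ (fun ξ => besselSymbol m 0 ξ * (𝓕 g : Lp ℂ 2 (volume : Measure ℝ)) ξ) x :=
    fun x => invFourierMul_toLp_apply hw _ x
  simp_rw [e2]
  have hintegrable := integrable_mul_of_memLp_two hw (𝓕 g)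
  -- Fubini moves the transform from the test function to the symbol; the sign in `-innerₗ ℝ`
  -- selects the inverse transform.
  have hswap := VectorFourier.integral_fourierIntegral_smul_eq_flip (L := -innerₗ ℝ)
    (μ := volume) (ν := volume) (e := Real.fourierChar) (f := φ)
    (g := fun ξ => besselSymbol m 0 ξ * (𝓕 g : Lp ℂ 2 (volume : Measure ℝ)) ξ)
    Real.continuous_fourierChar (by
      simp only [LinearMap.neg_apply, innerₗ_apply_apply]; fun_prop) φ.integrable hintegrable
  have e3 : ∀ ξ, (𝓕⁻ φ) ξ = VectorFourier.fourierIntegral Real.fourierChar volume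
      (-innerₗ ℝ) (φ : ℝ → ℂ) ξ := fun ξ => by
    rw [SchwartzMap.fourierInv_coe, Real.fourierInv_eq]
    simp [VectorFourier.fourierIntegral]
  have e4 : ∀ x, 𝓕⁻ (fun ξ => besselSymbol m 0 ξ * (𝓕 g : Lp ℂ 2 (volume : Measure ℝ)) ξ) x =
      VectorFourier.fourierIntegral Real.fourierChar volume (-innerₗ ℝ).flip
        (fun ξ => besselSymbol m 0 ξ * (𝓕 g : Lp ℂ 2 (volume : Measure ℝ)) ξ) x := fun x => by
    rw [Real.fourierInv_eq]
    simp [VectorFourier.fourierIntegral, mul_comm]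
  simp_rw [e4]
  simp only [smul_eq_mul] at hswap
  rw [← hswap]
  refine integral_congr_ae (Eventually.of_forall fun ξ => ?_)
  simp only
  rw [SchwartzMap.smulLeftCLM_apply_apply (hasTemperateGrowth_besselSymbol m 0), e3]
  simp only [smul_eq_mul]
  ring

end Sobolev

/-! ### From Sobolev-valued curves to pointwise solutions. -/

section Regularity

/-- `g ↦ ∂ₓᵏ f`, where `g` is the Bessel potential of order `m` of `f`. -/
noncomputable def besselDeriv {m : ℝ} {k : ℕ} (hk : MemLp (besselSymbol m k) 2 volume) :
    Lp ℂ 2 (volume : Measure ℝ) →L[ℝ] (ℝ →ᵇ ℂ) :=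
  (invFourierMul (hk.toLp _) ∘L
    (Lp.fourierTransformₗᵢ ℝ ℂ).toContinuousLinearEquiv.toContinuousLinearMap).restrictScalars ℝ

lemma besselDeriv_apply {m : ℝ} {k : ℕ} (hk : MemLp (besselSymbol m k) 2 volume)
    (g : Lp ℂ 2 (volume : Measure ℝ)) : besselDeriv hk g = invFourierMul (hk.toLp _) (𝓕 g) := rfl

lemma continuous_re_besselDeriv {m : ℝ} {k : ℕ} (hk : MemLp (besselSymbol m k) 2 volume)
    {c : ℝ → Lp ℂ 2 (volume : Measure ℝ)} (hc : Continuous c) :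
    Continuous (Function.uncurry fun t x => (besselDeriv hk (c t) x).re) := by
  refine Complex.continuous_re.comp ?_
  exact (((besselDeriv hk).continuous.comp hc).comp continuous_fst).eval continuous_snd

/-- A bounded symbol for the next derivative puts that derivative in `L²`, hence makes it locally
integrable. -/
lemma exists_primitive_besselDeriv {m : ℝ} {k : ℕ} (hk : MemLp (besselSymbol m k) 2 volume)
    (hk' : MemLp (besselSymbol m (k + 1)) ∞ volume) (g : Lp ℂ 2 (volume : Measure ℝ)) :
    ∃ h : ℝ → ℝ, LocallyIntegrable h volume ∧
      ∀ a b, (besselDeriv hk g b).re - (besselDeriv hk g a).re = ∫ x in a..b, h x := by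
  set H : Lp ℂ 2 (volume : Measure ℝ) := 𝓕⁻ (mulBounded (hk'.toLp _) (𝓕 g)) with hH
  have hHl : LocallyIntegrable H volume := (Lp.memLp H).locallyIntegrable (by norm_num)
  have hi : ∀ a b, IntervalIntegrable H volume a b := fun a b =>
    intervalIntegrable_iff.2 ((hHl.integrableOn_isCompact isCompact_uIcc).mono_set uIoc_subset_uIcc)
  have hle : ∀ a b, a ≤ b →
      (besselDeriv hk g b).re - (besselDeriv hk g a).re = ∫ x in a..b, (H x).re := by
    intro a b hab
    have h1 := invFourierMul_sub_eq_integral hk hk' (𝓕 g) hab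
    rw [← hH, ← intervalIntegral.integral_of_le hab] at h1
    rw [← Complex.sub_re, besselDeriv_apply, h1]
    exact (Complex.reCLM.intervalIntegral_comp_comm (hi a b)).symm
  refine ⟨fun x => (H x).re, fun x => ?_, fun a b => ?_⟩
  · obtain ⟨s, hs, hintegrable⟩ := hHl x
    exact ⟨s, hs, hintegrable.re⟩
  · rcases le_total a b with hab | hab
    · exact hle a b hab
    · rw [intervalIntegral.integral_symm, ← hle b a hab]; ring

/-- Functions in `C¹([0,T]; H^m(ℝ))` with `m > 2` are classical `C¹` functions, and their space
derivative is locally absolutely continuous. -/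
theorem IsC1Sobolev.exists_field {m T : ℝ} {f : ℝ → ℝ → ℝ} (hm : 2 < m) (hT : 0 < T)
    (hf : IsC1Sobolev m T f) :
    ∃ F Fx Ft : ℝ → ℝ → ℝ, IsC1Field T F Fx Ft ∧ (∀ t ∈ Icc 0 T, F t = f t) ∧
      (∃ C : ℝ, ∀ t x, |F t x| ≤ C ∧ |Fx t x| ≤ C) ∧ (∀ t, MemLp (F t) 2 volume) ∧
      ∀ t, ∃ h : ℝ → ℝ, LocallyIntegrable h volume ∧
        ∀ a b, Fx t b - Fx t a = ∫ x in a..b, h x := by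
  obtain ⟨g, hg, hlift⟩ := hf
  have h0 : MemLp (besselSymbol m 0) 2 volume := memLp_two_besselSymbol (by norm_num; linarith)
  have h1 : MemLp (besselSymbol m 1) 2 volume := memLp_two_besselSymbol (by norm_num; linarith)
  have h2 : MemLp (besselSymbol m 2) ∞ volume := memLp_top_besselSymbol (by norm_num; linarith)
  -- Freezing time outside `[0,T]` extends the fields continuously to all times, which gives global
  -- bounds.
  set p : ℝ → ℝ := fun t => (projIcc 0 T hT.le t : ℝ) with hp
  have hpc : Continuous p := continuous_subtype_val.comp continuous_projIcc
  have hpm : ∀ t, p t ∈ Icc 0 T := fun t => (projIcc 0 T hT.le t).2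
  have hpi : ∀ t ∈ Icc 0 T, p t = t := fun t ht => by simp [hp, projIcc_of_mem hT.le ht]
  set g' : ℝ → Lp ℂ 2 (volume : Measure ℝ) := derivWithin g (Icc 0 T) with hg'
  have hg'c : ContinuousOn g' (Icc 0 T) :=
    hg.continuousOn_derivWithin (uniqueDiffOn_Icc hT) le_rfl
  have hc : Continuous fun t => g (p t) := hg.continuousOn.comp_continuous hpc hpm
  have hc' : Continuous fun t => g' (p t) := hg'c.comp_continuous hpc hpm
  have hgd : ∀ t ∈ Ioo 0 T, HasDerivAt g (g' t) t := fun t ht =>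
    ((hg.differentiableOn one_ne_zero) t (Ioo_subset_Icc_self ht)).hasDerivWithinAt.hasDerivAt
      (Icc_mem_nhds ht.1 ht.2)
  have hval : ∀ t x, (besselDeriv h0 (g (p t)) x).re = f (p t) x := fun t x => by
    rw [besselDeriv_apply, ← (hlift (p t) (hpm t)).eq_invFourierMul h0 x, Complex.ofReal_re]
  refine ⟨fun t x => (besselDeriv h0 (g (p t)) x).re, fun t x => (besselDeriv h1 (g (p t)) x).re,
    fun t x => (besselDeriv h0 (g' (p t)) x).re,
    ⟨continuous_re_besselDeriv h0 hc, continuous_re_besselDeriv h1 hc,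
      continuous_re_besselDeriv h0 hc', fun t x => ?_, fun t ht x => ?_⟩, fun t ht => ?_, ?_,
      fun t => ?_, fun t => exists_primitive_besselDeriv h1 h2 (g (p t))⟩
  · exact (Complex.reCLM.hasFDerivAt.comp_hasDerivAt x
      (hasDerivAt_invFourierMul h0 h1 (𝓕 (g (p t))) x))
  · have e1 := ((Complex.reCLM ∘L BoundedContinuousFunction.evalCLM ℝ x) ∘L
      besselDeriv h0).hasFDerivAt.comp_hasDerivAt t (hgd t ht)
    simp only [hpi t (Ioo_subset_Icc_self ht)]
    refine e1.congr_of_eventuallyEq ?_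
    filter_upwards [Icc_mem_nhds ht.1 ht.2] with s hs
    simp [hpi s hs]
  · funext x
    exact (hval t x).trans (by rw [hpi t ht])
  · obtain ⟨B, hB⟩ := (isCompact_Icc (a := (0 : ℝ)) (b := T)).exists_bound_of_continuousOn
      hg.continuousOn
    have hB0 : 0 ≤ B := (norm_nonneg _).trans (hB (p 0) (hpm 0))
    refine ⟨max (‖besselDeriv h0‖ * B) (‖besselDeriv h1‖ * B), fun t x => ⟨?_, ?_⟩⟩
    · refine le_max_of_le_left ((Complex.abs_re_le_norm _).trans ?_)
      refine ((besselDeriv h0 (g (p t))).norm_coe_le_norm x).trans ?_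
      exact ((besselDeriv h0).le_opNorm _).trans (by gcongr; exact hB _ (hpm t))
    · refine le_max_of_le_right ((Complex.abs_re_le_norm _).trans ?_)
      refine ((besselDeriv h1 (g (p t))).norm_coe_le_norm x).trans ?_
      exact ((besselDeriv h1).le_opNorm _).trans (by gcongr; exact hB _ (hpm t))
  · obtain ⟨-, hmem, -⟩ := hlift (p t) (hpm t)
    simp only [hval]
    exact hmem.re

lemma IsC1Field.deriv_eq_of_eq {T : ℝ} {f F Fx Ft : ℝ → ℝ → ℝ} (hF : IsC1Field T F Fx Ft)
    (h : ∀ t ∈ Icc 0 T, F t = f t) {t : ℝ} (ht : t ∈ Ioo 0 T) (x : ℝ) :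
    deriv (fun s => f s x) t = Ft t x := by
  refine ((hF.deriv_t t ht x).congr_of_eventuallyEq ?_).deriv
  filter_upwards [Icc_mem_nhds ht.1 ht.2] with s hs
  rw [h s hs]

/-- Lebesgue differentiation; it identifies the classical `uₓₓ` of the momentum equation with the
density of `uₓ`. -/
lemma ae_deriv_eq_of_primitive {f h : ℝ → ℝ} (hh : LocallyIntegrable h volume)
    (hf : ∀ a b, f b - f a = ∫ x in a..b, h x) : ∀ᵐ x, deriv f x = h x := by
  filter_upwards [LocallyIntegrable.ae_hasDerivAt_integral hh] with x hx
  have : f = fun y => f 0 + ∫ z in (0 : ℝ)..y, h z := by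
    ext y; rw [← hf 0 y]; ring
  rw [this]
  exact ((hx 0).const_add (f 0)).deriv

lemma eq_zero_of_ae_eq_zero {f : ℝ → ℝ} (hf : Continuous f) (h : ∀ᵐ x, f x = 0) (x : ℝ) :
    f x = 0 :=
  congrFun ((Continuous.ae_eq_iff_eq volume hf continuous_const).1 h) x

/-- A solution in `C¹([0,T]; H^m(ℝ))`, `m > 2`, solves the equations pointwise. -/
theorem IsSolution.exists_pointwise {μ lam γ m T : ℝ} {ρ₀ u₀ e₀ : ℝ → ℝ} {ρ u e : ℝ → ℝ → ℝ}
    (hm : 2 < m) (hT : 0 < T) (h : IsSolution μ lam γ m T ρ₀ u₀ e₀ ρ u e) :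
    ∃ R Rx Rt U Ux Ut Q Qx Qt : ℝ → ℝ → ℝ,
      IsPointwiseSolution (2 * μ + lam) γ T R Rx Rt U Ux Ut Q Qx Qt ∧
      (∀ x, R 0 x = ρ₀ x) ∧ (∀ x, U 0 x = u₀ x) ∧ ∀ x, Q 0 x = ρ₀ x * e₀ x := by
  obtain ⟨R, Rx, Rt, hR, hRe, ⟨CR, hCR⟩, -, -⟩ := h.regular_density.exists_field hm hT
  obtain ⟨U, Ux, Ut, hU, hUe, ⟨CU, hCU⟩, hUL, hUp⟩ := h.regular_velocity.exists_field hm hT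
  obtain ⟨E, Ex, Et, hE, hEe, -, -, -⟩ := h.regular_energy.exists_field hm hT
  have hQ := hR.mul hE
  have hM := hR.mul hU
  have h0 : (0 : ℝ) ∈ Icc 0 T := ⟨le_rfl, hT.le⟩
  have eqM : ∀ t ∈ Icc 0 T, (fun x => R t x * U t x) = fun x => ρ t x * u t x := fun t ht => by
    rw [hRe t ht, hUe t ht]
  have eqQ : ∀ t ∈ Icc 0 T, (fun x => R t x * E t x) = fun x => ρ t x * e t x := fun t ht => by
    rw [hRe t ht, hEe t ht]
  refine ⟨R, Rx, Rt, U, Ux, Ut, _, _, _, ⟨hR, hU, hQ, ⟨max CR CU, fun t x => ?_⟩, hUL,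
    fun t x hx => by simp [hx], fun t ht => ?_, fun t ht => ?_, fun t ht a b => ?_⟩,
    fun x => by rw [hRe 0 h0, h.initial_density], fun x => by rw [hUe 0 h0, h.initial_velocity],
    fun x => by rw [hRe 0 h0, hEe 0 h0, h.initial_density, h.initial_energy]⟩
  · exact ⟨(hCR t x).1.trans (le_max_left _ _), (hCU t x).1.trans (le_max_right _ _),
      (hCU t x).2.trans (le_max_right _ _)⟩
  · have ht' := Ioo_subset_Icc_self ht
    refine eq_zero_of_ae_eq_zero (((hR.continuous_slice_t t).add ((hR.continuous_slice_x t).mul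
      (hU.continuous_slice t))).add ((hR.continuous_slice t).mul (hU.continuous_slice_x t))) ?_
    filter_upwards [h.mass t ht] with x hx
    rw [hR.deriv_eq_of_eq hRe ht, ← eqM t ht', (hM.deriv_x t x).deriv] at hx
    linarith
  · have ht' := Ioo_subset_Icc_self ht
    -- The factor `γ` collects `q uₓ` from the flux and `(γ - 1) q uₓ` from the pressure work; the
    -- two dissipation terms add up to `(2μ + λ) uₓ²`.
    have key : ∀ᵐ x, (Rt t x * E t x + R t x * Et t x) + (Rx t x * E t x + R t x * Ex t x) * U t x +
        γ * (R t x * E t x * Ux t x) - (2 * μ + lam) * Ux t x ^ 2 = 0 := by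
      filter_upwards [h.energy t ht] with x hx
      have e1 : (fun y => ρ t y * e t y * u t y) = fun y => R t y * E t y * U t y := by
        rw [hRe t ht', hEe t ht', hUe t ht']
      rw [hQ.deriv_eq_of_eq eqQ ht, e1, ((hQ.mul hU).deriv_x t x).deriv, pressure,
        ← hUe t ht', ← hRe t ht', ← hEe t ht', (hU.deriv_x t x).deriv] at hx
      linarith
    intro x
    refine sub_eq_zero.1 (eq_zero_of_ae_eq_zero ?_ key x)
    have c1 := hQ.continuous_slice_t t
    have c2 := hQ.continuous_slice_x t
    have c3 := hQ.continuous_slice t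
    have c4 := hU.continuous_slice t
    have c5 := hU.continuous_slice_x t
    fun_prop
  · have ht' := Ioo_subset_Icc_self ht
    obtain ⟨k, hk, hkp⟩ := hUp t
    have hki : IntervalIntegrable k volume a b := intervalIntegrable_iff.2
      ((hk.integrableOn_isCompact isCompact_uIcc).mono_set uIoc_subset_uIcc)
    have hF := hM.mul hU
    have hux : deriv (u t) = Ux t := funext fun x => by
      rw [← hUe t ht', (hU.deriv_x t x).deriv]
    have hdF : ∀ x, HasDerivAt (fun y => R t y * U t y * U t y + (γ - 1) * (R t y * E t y))
        (((Rx t x * U t x + R t x * Ux t x) * U t x + R t x * U t x * Ux t x) +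
          (γ - 1) * (Rx t x * E t x + R t x * Ex t x)) x := fun x =>
      (hF.deriv_x t x).add ((hQ.deriv_x t x).const_mul (γ - 1))
    have hdFc : Continuous fun x => ((Rx t x * U t x + R t x * Ux t x) * U t x +
        R t x * U t x * Ux t x) + (γ - 1) * (Rx t x * E t x + R t x * Ex t x) :=
      (hF.continuous_slice_x t).add (continuous_const.mul (hQ.continuous_slice_x t))
    have key : ∀ᵐ x, x ∈ uIoc a b → Rt t x * U t x + R t x * Ut t x = (2 * μ + lam) * k x -
        (((Rx t x * U t x + R t x * Ux t x) * U t x + R t x * U t x * Ux t x) +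
          (γ - 1) * (Rx t x * E t x + R t x * Ex t x)) := by
      filter_upwards [h.momentum t ht, ae_deriv_eq_of_primitive hk hkp] with x hx hkx _
      have e1 : (fun y => ρ t y * u t y * u t y) = fun y => R t y * U t y * U t y := by
        rw [hRe t ht', hUe t ht']
      have e2 : (fun y => pressure γ ρ e t y) = fun y => (γ - 1) * (R t y * E t y) := by
        rw [hRe t ht', hEe t ht']
        funext y
        rw [pressure, mul_assoc]
      rw [hM.deriv_eq_of_eq eqM ht, e1, (hF.deriv_x t x).deriv, e2,
        ((hQ.deriv_x t x).const_mul (γ - 1)).deriv, hux, hkx] at hx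
      linarith
    rw [intervalIntegral.integral_congr_ae key, intervalIntegral.integral_sub
      (hki.const_mul _) (hdFc.intervalIntegrable _ _), intervalIntegral.integral_const_mul,
      ← hkp a b, intervalIntegral.integral_eq_sub_of_hasDerivAt (fun x _ => hdF x)
      (hdFc.intervalIntegrable _ _)]
    ring

/-- Beyond the complement of the support, continuity adds the end points `0` and `1`. -/
lemma eq_zero_of_notMem_Ioo {f : ℝ → ℝ} (hf : Continuous f) (hs : tsupport f = Icc 0 1) {x : ℝ}
    (hx : x ∉ Ioo (0 : ℝ) 1) : f x = 0 := by
  have h1 : (Icc (0 : ℝ) 1)ᶜ ⊆ {x | f x = 0} := fun y hy =>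
    image_eq_zero_of_notMem_tsupport (by rwa [hs])
  have h2 := closure_minimal h1 (isClosed_eq hf continuous_const)
  refine h2 ?_
  rwa [closure_compl, interior_Icc]

end Regularity

end FullNS

theorem theorem1p2 (μ lam γ : ℝ) (hμ : 0 < μ) (hlam : 0 < 2 * μ + lam) (hγ : 1 < γ)
    (ρ₀ u₀ e₀ : ℝ → ℝ)
    (hρ₀c : Continuous ρ₀) (hu₀c : Continuous u₀) (he₀c : Continuous e₀)
    (hsupp : tsupport ρ₀ = Set.Icc 0 1) (hpos : ∀ x ∈ Set.Ioo (0 : ℝ) 1, 0 < ρ₀ x)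
    (he₀ : ∀ x ∈ Set.Ioo (0 : ℝ) 1, 0 ≤ e₀ x) (he₀' : ∃ x ∈ Set.Ioo (0 : ℝ) 1, e₀ x ≠ 0)
    (hdata : FullNS.LeftCondition ρ₀ u₀ e₀ ∨ FullNS.RightCondition ρ₀ u₀ e₀)
    (m : ℝ) (hm : 2 < m) (T : ℝ) (hT : 0 < T) :
    ¬ ∃ ρ u e : ℝ → ℝ → ℝ, FullNS.IsSolution μ lam γ m T ρ₀ u₀ e₀ ρ u e := by
  rintro ⟨ρ, u, e, hsol⟩
  obtain ⟨R, Rx, Rt, U, Ux, Ut, Q, Qx, Qt, h, hR, hU, hQ⟩ := hsol.exists_pointwise hm hT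
  have hvac : ∀ x, x ∉ Set.Ioo 0 1 → R 0 x = 0 := fun x hx => by
    rw [hR, FullNS.eq_zero_of_notMem_Ioo hρ₀c hsupp hx]
  have hposR : ∀ x ∈ Set.Ioo 0 1, 0 < R 0 x := fun x hx => by
    rw [hR]; exact hpos x hx
  have hQ0 : ∀ x, 0 ≤ Q 0 x := fun x => by
    rw [hQ]
    -- Outside the gas `e₀` may have either sign, but it is multiplied by zero density.
    by_cases hx : x ∈ Set.Ioo (0 : ℝ) 1
    · exact mul_nonneg (hpos x hx).le (he₀ x hx)
    · rw [FullNS.eq_zero_of_notMem_Ioo hρ₀c hsupp hx, zero_mul]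
  rcases hdata with ⟨-, l, -, hl0, hl1, -, hul, hu⟩ | ⟨-, l, -, hl0, hl1, -, hul, hu⟩
  · exact h.false_of_left hlam hγ.le hT hvac hposR hQ0 ⟨hl0, hl1⟩ (by rwa [hU])
      fun x hx => by rw [hU]; exact hu x hx
  · exact h.false_of_right hlam hγ.le hT hvac hposR hQ0 ⟨hl0, hl1⟩ (by rwa [hU])
      fun x hx => by rw [hU]; exact hu x hx
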